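/- Let $[n]=\{1,\dots,n\}$, let $\mathfrak S_n$ be the set of permutations of $[n]$, and let an automaton on $[n]$ be a pair $A$ of functions $a,b:[n]\to[n]$. Let $\mathcal A$ be the set of automata on $[n]$ and let $\mathcal A^{\bullet\diamond}=\mathcal A\times[n]\times\mathfrak S_n$. Let $w=w^1\cdots w^k$ be a word of length $k\ge1$ over $\{a,b\}$, with indices of letters read modulo $k$; it is self-conjugate if it equals one of its nontrivial cyclic rotations. For $u\in[n]$ and $r\in\mathbb Z/k$, put $u_0=u$ and $u_{i+1}=w^{r+i+1}(u_i)$ for $i\ge 0$. Let $T$ be the least $j\ge1$ for which there is $i<j$ with $u_i=u_j$ and $i\equiv j \pmod k$, and let $\tilde T$ be this $i$ for $j=T$. The $w$-thread of $(u,r)$ is the sequence $((u_i,r+i))_{0\le i\le T-1}$ in $[n]\times\mathbb Z/k$. Let $A_w:[n]\to[n]$ be the map obtained by applying $w^1,w^2,\dots,w^k$ successively; $A$ is a $w$-tree if $A_w$ has exactly one cyclic point, i.e. exactly one $v$ with $A_w^m(v)=v$ for some $m\ge1$. If $A$ is a $w$-tree and $v\in[n]$, then $(A,v)$ is $0$-shifted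 if the length $T$ of the $w$-thread of $(v,0)$ is divisible by $k$. Given $(A,v,\sigma)\in\mathcal A^{\bullet\diamond}$, let $(u_i)$, $T$, $\tilde T$ be as above for $(v,0)$, let $\mathbf b_1,\dots,\mathbf b_\ell$ be the vertices $u_{ki}$, $0\le i\le\lfloor\tilde T/k\rfloor$, for which $\sigma(u_{ki})<\sigma(u_{kj})$ for all $0\le j<i$, and let $\mathbf b_{\ell+1}=u_{\tilde T}$. Call $(A,v,\sigma)$ branch-good if, for all $p,q\in\{1,\dots,\ell+1\}$ and $r,s\in\mathbb Z/k$, whenever $(\mathbf b_q,s)$ appears in the $w$-thread of $(\mathbf b_p,r)$ at a position other than the starting one, then $s=0$. Let $\widehat{\mathcal B}_w$ be the set of branch-good $(A,v,\sigma)\in\mathcal A^{\bullet\diamond}$ such that $A$ is a $w$-tree and $(A,v)$ is $0$-shifted. Then, as $n\to\infty$, uniformly over all $1\le k\le 2\log_2 n$ and all words $w$ of length $k$ that are not self-conjugate, $$|\widehat{\mathcal B}_w|\sim\frac{|\mathcal A^{\bullet\diamond}|}{n}.$$ Equivalently, a uniformly random element of $\mathcal A^{\bullet\diamond}$ lies in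 $\widehat{\mathcal B}_w$ with probability asymptotic to $1/n$, uniformly in $k$ and $w$ as above. -/

import Mathlib

/-- The alphabet `{a, b}`: `false` stands for `a` and `true` for `b`. -/
abbrev Letter : Type := Bool

/-- An automaton on the vertex set `[n]`: one transition function for each letter. -/
abbrev Automaton (n : ℕ) : Type := Letter → Fin n → Fin n

/-- The set `𝒜^{•◇} = 𝒜 × [n] × 𝔖ₙ` of automata with a marked vertex and a labelling. -/
abbrev MarkedLabelledAutomaton (n : ℕ) : Type := Automaton n × Fin n × Equiv.Perm (Fin n)

/-- A word `w = w¹w²…wᵏ` of length `k ≥ 1`. Its letters are indexed by the integers modulo `k`: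
the first letter is `w 1`, the second one is `w 2`, and the last one is `w k = w 0`. -/
abbrev Word (k : ℕ) : Type := ZMod k → Letter

/-- A word is self-conjugate if a nontrivial cyclic rotation fixes it. -/
def IsSelfConjugate {k : ℕ} (w : Word k) : Prop :=
  ∃ c : ZMod k, c ≠ 0 ∧ ∀ j : ZMod k, w (j + c) = w j

/-- The vertices `u₀ = u, u₁, u₂, …` of the infinite sequence of transitions that starts at `u`
with congruence `r`: the step from `uᵢ` to `uᵢ₊₁` reads the letter `w^{r+i+1}`. -/
def walk {n k : ℕ} (A : Automaton n) (w : Word k) (u : Fin n) (r : ZMod k) : ℕ → Fin n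
  | 0 => u
  | i + 1 => A (w (r + (i : ZMod k) + 1)) (walk A w u r i)

/-- The first time `T` at which a pair (vertex, time modulo `k`) is repeated in the walk.
For `k ≥ 1` such a time exists by the pigeonhole principle. -/
noncomputable def threadLength {n k : ℕ} (A : Automaton n) (w : Word k)
    (u : Fin n) (r : ZMod k) : ℕ :=
  sInf {j : ℕ | 1 ≤ j ∧ ∃ i < j, walk A w u r i = walk A w u r j ∧ i ≡ j [MOD k]}

/-- The time `T̃`: the unique `i < T` with `uᵢ = u_T` and `i ≡ T` modulo `k`. -/
noncomputable def tailLength {n k : ℕ} (A : Automaton n) (w : Word k)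
    (u : Fin n) (r : ZMod k) : ℕ :=
  sInf {i : ℕ | i < threadLength A w u r ∧
    walk A w u r i = walk A w u r (threadLength A w u r) ∧ i ≡ threadLength A w u r [MOD k]}

/-- The `w`-thread of `(u, r)`: the list of the pairs `(uᵢ, r + i)` for `0 ≤ i ≤ T - 1`. -/
noncomputable def thread {n k : ℕ} (A : Automaton n) (w : Word k)
    (u : Fin n) (r : ZMod k) : List (Fin n × ZMod k) :=
  (List.range (threadLength A w u r)).map fun i => (walk A w u r i, r + (i : ZMod k))

/-- `(u, r) →^w (v, s)`: the pair `(v, s)` appears in the `w`-thread of `(u, r)`. -/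
def Reaches {n k : ℕ} (A : Automaton n) (w : Word k)
    (u : Fin n) (r : ZMod k) (v : Fin n) (s : ZMod k) : Prop :=
  (v, s) ∈ thread A w u r

/-- The one-letter automaton `A_w` of the `w`-transitions of `A`. -/
def inducedMap {n k : ℕ} (A : Automaton n) (w : Word k) : Fin n → Fin n :=
  fun u => walk A w u 0 k

/-- `A` is a `w`-tree: `A_w` has a unique cyclic point. -/
def IsWTree {n k : ℕ} (A : Automaton n) (w : Word k) : Prop :=
  ∃! v : Fin n, v ∈ Function.periodicPts (inducedMap A w)

/-- `(A, v)` is `r`-shifted: `A` is a `w`-tree and the length `T` of the `w`-thread of `(v, 0)`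
is congruent to `r` modulo `k`. -/
def IsShifted {n k : ℕ} (A : Automaton n) (w : Word k) (v : Fin n) (r : ZMod k) : Prop :=
  IsWTree A w ∧ (threadLength A w v 0 : ZMod k) = r

/-- The `i` with `0 ≤ i ≤ ⌊T̃ / k⌋` such that `i` is a (strict) lower record of the sequence
`i ↦ σ(u_{ki})` along the `w`-thread of `(v, 0)`, in increasing order. -/
noncomputable def lowerRecords {n k : ℕ} (A : Automaton n) (w : Word k)
    (v : Fin n) (σ : Equiv.Perm (Fin n)) : List ℕ :=
  (List.range (tailLength A w v 0 / k + 1)).filter fun i =>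
    decide (∀ j < i, σ (walk A w v 0 (k * i)) < σ (walk A w v 0 (k * j)))

/-- The vertices `b₁, …, b_ℓ, b_{ℓ+1}`: the vertices that realize the lower records along the
branch of `v`, followed by the vertex `u_{T̃}` at which the thread becomes periodic. -/
noncomputable def branchVertices {n k : ℕ} (A : Automaton n) (w : Word k)
    (v : Fin n) (σ : Equiv.Perm (Fin n)) : List (Fin n) :=
  (lowerRecords A w v σ).map (fun i => walk A w v 0 (k * i)) ++
    [walk A w v 0 (tailLength A w v 0)]

/-- `(A, v, σ)` is branch-good: whenever `(b_p, r) →^w (b_q, s)`, then `s = 0`. The appearance of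
`(b_p, r)` as the starting pair of its own thread is not counted. -/
def IsBranchGood {n k : ℕ} (A : Automaton n) (w : Word k)
    (v : Fin n) (σ : Equiv.Perm (Fin n)) : Prop :=
  ∀ x ∈ branchVertices A w v σ, ∀ y ∈ branchVertices A w v σ, ∀ r s : ZMod k,
    (y, s) ≠ (x, r) → Reaches A w x r y s → s = 0

/-- The set of the labelled marked `w`-trees on `[n]` that are `0`-shifted and branch-good. -/
def goodMarkedTrees (n : ℕ) {k : ℕ} (w : Word k) : Set (MarkedLabelledAutomaton n) :=
  {x | IsBranchGood x.1 w x.2.1 x.2.2 ∧ IsWTree x.1 w ∧ IsShifted x.1 w x.2.1 0}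

/-- The uniform probability of a set `S` of labelled marked automata. -/
noncomputable def uniformProb {n : ℕ} (S : Set (MarkedLabelledAutomaton n)) : ℝ :=
  (S.ncard : ℝ) / (Nat.card (MarkedLabelledAutomaton n) : ℝ)

/-!
Reading the letters of `w` cyclically is a self-map of `[n] × ℤ/k` whose orbits are the threads.
Cutting the branch of `v` at the lower records of `σ` and closing every block into a cycle changes
only the last transition of each block, because a branch-good triple visits the cut vertices only at
congruence `0`. As in Foata's correspondence the records recover the blocks, so at most `|𝒜| · n!`
triples are counted.

Conversely, concatenating the cycles of `A_w` by decreasing minimal label turns a pair `(A, σ)` into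
a triple that is counted, provided the minima of the cycles and their predecessors return to each
other only at congruence `0`. This fails for two reasons. Either some thread is longer than `2k²a`,
which is exponentially unlikely once `a² / n` is large; or a walk meets a cycle at a wrong
congruence. Since `w` is not self-conjugate, that walk soon leaves the cycle and has to meet it
again, so that an exploration of `A` sees two independent coincidences, or three when two cycles are
involved. Each costs a factor `1 / n`, while being the minimal label on a cycle of length `L` costs
`1 / L`; the union bound is of order `n ^ (2 / 3) / n` up to logarithms for `a ≈ n ^ (2 / 3)`.
-/

open Function

section Iteration

variable {α : Type*} {f : α → α} {x : α}

lemma exists_lt_iterate_eq_iterate [Finite α] (f : α → α) (x : α) :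
    ∃ j, ∃ i < j, f^[i] x = f^[j] x := by
  obtain ⟨i, j, hij, h⟩ := Finite.exists_ne_map_eq_of_infinite fun i : ℕ => f^[i] x
  rcases lt_or_gt_of_ne hij with hlt | hlt
  · exact ⟨j, i, hlt, h⟩
  · exact ⟨i, j, hlt, h.symm⟩

lemma exists_iterate_mem_periodicPts [Finite α] (f : α → α) (x : α) :
    ∃ m, f^[m] x ∈ periodicPts f := by
  obtain ⟨j, i, hij, h⟩ := exists_lt_iterate_eq_iterate f x
  refine ⟨i, j - i, by lia, ?_⟩
  rw [IsPeriodicPt, IsFixedPt, ← iterate_add_apply, Nat.sub_add_cancel hij.le, h]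

lemma exists_iterate_iterate_eq_of_mem_periodicPts (hx : x ∈ periodicPts f) (m : ℕ) :
    ∃ l, f^[l] (f^[m] x) = x := by
  obtain ⟨p, hp, hper⟩ := hx
  refine ⟨p * m - m, ?_⟩
  rw [← iterate_add_apply, Nat.sub_add_cancel (Nat.le_mul_of_pos_left m hp)]
  exact hper.mul_const m

lemma iterate_apply_of_forall_apply_eq_succ {c : ℕ → α} (h : ∀ i, f (c i) = c (i + 1)) (i m : ℕ) :
    f^[m] (c i) = c (i + m) := by
  induction m with
  | zero => rfl
  | succ m ih => rw [iterate_succ_apply', ih, h, add_assoc]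

lemma periodicPts_eq_of_injOn {P : Set α} (hfin : P.Finite) (hmaps : Set.MapsTo f P P)
    (hinj : Set.InjOn f P) (hmem : ∀ x ∈ periodicPts f, ∃ m, f^[m] x ∈ P) : periodicPts f = P := by
  apply Set.Subset.antisymm
  · intro x hx
    obtain ⟨m, hm⟩ := hmem x hx
    obtain ⟨l, hl⟩ := exists_iterate_iterate_eq_of_mem_periodicPts hx m
    exact hl ▸ hmaps.iterate l hm
  · intro x hx
    have := hfin.to_subtype
    obtain ⟨p, hp, h⟩ := (hmaps.restrict_inj.2 hinj).mem_periodicPts ⟨x, hx⟩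
    refine ⟨p, hp, ?_⟩
    rw [IsPeriodicPt, IsFixedPt, hmaps.iterate_restrict, Subtype.ext_iff] at h
    exact h

end Iteration

/-- The exploded transition system of `A` and `w`: one transition on pairs (vertex, congruence),
so that walks of `A` along `w` become orbits of a single map. -/
def explode {n k : ℕ} (A : Automaton n) (w : Word k) (o : Fin n × ZMod k) : Fin n × ZMod k :=
  (A (w (o.2 + 1)) o.1, o.2 + 1)

section Explode

variable {n k : ℕ} (A : Automaton n) (w : Word k) (u : Fin n) (r : ZMod k)

lemma walk_succ (i : ℕ) : walk A w u r (i + 1) = A (w (r + i + 1)) (walk A w u r i) := rfl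

lemma explode_iterate (i : ℕ) : (explode A w)^[i] (u, r) = (walk A w u r i, r + i) := by
  induction i with
  | zero => simp [walk]
  | succ i ih => simp [iterate_succ_apply', ih, explode, walk, add_assoc]

lemma explode_iterate_snd (o : Fin n × ZMod k) (i : ℕ) : ((explode A w)^[i] o).2 = o.2 + i :=
  congrArg Prod.snd (explode_iterate A w o.1 o.2 i)

lemma explode_iterate_mul (i : ℕ) :
    (explode A w)^[k * i] (u, 0) = ((inducedMap A w)^[i] u, 0) := by
  rw [iterate_mul]
  induction i with
  | zero => rfl
  | succ i ih =>
    rw [iterate_succ_apply', ih, iterate_succ_apply', explode_iterate, CharP.cast_eq_zero, add_zero]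
    rfl

lemma walk_mul (i : ℕ) : walk A w u 0 (k * i) = (inducedMap A w)^[i] u := by
  have h := explode_iterate_mul A w u i
  rw [explode_iterate] at h
  exact congrArg Prod.fst h

variable {A w u} in
lemma exists_iterate_inducedMap_eq {v : Fin n} {j : ℕ} (h : (explode A w)^[j] (u, 0) = (v, 0)) :
    ∃ m, (inducedMap A w)^[m] u = v := by
  have hj := congrArg Prod.snd h
  rw [explode_iterate_snd, zero_add, ZMod.natCast_eq_zero_iff] at hj
  obtain ⟨m, rfl⟩ := hj
  rw [explode_iterate_mul] at h
  exact ⟨m, congrArg Prod.fst h⟩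

lemma explode_iterate_eq_iff (i j : ℕ) : (explode A w)^[i] (u, r) = (explode A w)^[j] (u, r) ↔
    walk A w u r i = walk A w u r j ∧ i ≡ j [MOD k] := by
  rw [explode_iterate, explode_iterate, Prod.mk.injEq, add_right_inj, ZMod.natCast_eq_natCast_iff]

lemma mem_periodicPts_explode_iff [NeZero k] :
    (u, (0 : ZMod k)) ∈ periodicPts (explode A w) ↔ u ∈ periodicPts (inducedMap A w) := by
  constructor
  · rintro ⟨p, hp, h⟩
    have hreturn : (explode A w)^[k * p] (u, 0) = (u, 0) := h.const_mul k
    rw [explode_iterate_mul] at hreturn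
    exact ⟨p, hp, congrArg Prod.fst hreturn⟩
  · rintro ⟨p, hp, h⟩
    refine ⟨k * p, Nat.mul_pos (NeZero.pos k) hp, ?_⟩
    rw [IsPeriodicPt, IsFixedPt, explode_iterate_mul, h]

variable {A w} in
lemma dvd_of_isPeriodicPt_explode {o : Fin n × ZMod k} {p : ℕ}
    (h : IsPeriodicPt (explode A w) p o) : k ∣ p := by
  have hsnd := congrArg Prod.snd h.eq
  rwa [explode_iterate_snd, add_eq_left, ZMod.natCast_eq_zero_iff] at hsnd

lemma exists_explode_iterate_snd_eq_zero [NeZero k] (o : Fin n × ZMod k) :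
    ∃ j v, (explode A w)^[j] o = (v, 0) := by
  refine ⟨(-o.2).val, _, Prod.ext rfl ?_⟩
  rw [explode_iterate_snd, ZMod.natCast_zmod_val, add_neg_cancel]

lemma exists_explode_iterate_mem_periodicPts [NeZero k] (o : Fin n × ZMod k) :
    ∃ j, ∃ v ∈ periodicPts (inducedMap A w), (explode A w)^[j] o = (v, 0) := by
  obtain ⟨j, v, h⟩ := exists_explode_iterate_snd_eq_zero A w o
  obtain ⟨m, hm⟩ := exists_iterate_mem_periodicPts (inducedMap A w) v
  exact ⟨k * m + j, _, hm, by rw [iterate_add_apply, h, explode_iterate_mul]⟩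

end Explode

section Threads

variable {n k : ℕ} (A : Automaton n) (w : Word k) (u : Fin n) (r : ZMod k)

lemma threadLength_eq_sInf : threadLength A w u r =
    sInf {j : ℕ | ∃ i < j, (explode A w)^[i] (u, r) = (explode A w)^[j] (u, r)} := by
  simp only [threadLength, explode_iterate_eq_iff]
  congr! 3 with j
  exact and_iff_right_of_imp fun ⟨i, hij, _⟩ => by lia

lemma injOn_explode_iterate_threadLength :
    Set.InjOn (fun i => (explode A w)^[i] (u, r)) (Set.Iio (threadLength A w u r)) := by
  intro i hi j hj h
  rw [threadLength_eq_sInf, Set.mem_Iio] at hi hj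
  rcases lt_trichotomy i j with hlt | heq | hlt
  · exact absurd ⟨i, hlt, h⟩ (Nat.notMem_of_lt_sInf hj)
  · exact heq
  · exact absurd ⟨j, hlt, h.symm⟩ (Nat.notMem_of_lt_sInf hi)

variable [NeZero k]

lemma exists_lt_threadLength_iterate_eq : ∃ i < threadLength A w u r,
    (explode A w)^[i] (u, r) = (explode A w)^[threadLength A w u r] (u, r) := by
  have hmem := Nat.sInf_mem (s := {j : ℕ | ∃ i < j,
    (explode A w)^[i] (u, r) = (explode A w)^[j] (u, r)})
    (exists_lt_iterate_eq_iterate (explode A w) (u, r))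
  rwa [← threadLength_eq_sInf] at hmem

lemma tailLength_spec : tailLength A w u r < threadLength A w u r ∧
    (explode A w)^[tailLength A w u r] (u, r) = (explode A w)^[threadLength A w u r] (u, r) := by
  have h := exists_lt_threadLength_iterate_eq A w u r
  simp only [explode_iterate_eq_iff] at h ⊢
  exact Nat.sInf_mem (s := {i : ℕ | i < threadLength A w u r ∧
    walk A w u r i = walk A w u r (threadLength A w u r) ∧ i ≡ threadLength A w u r [MOD k]}) h

variable {A w u r}

lemma threadLength_eq_and_tailLength_eq {t T : ℕ} (htT : t < T)
    (h : (explode A w)^[t] (u, r) = (explode A w)^[T] (u, r))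
    (hinj : Set.InjOn (fun i => (explode A w)^[i] (u, r)) (Set.Iio T)) :
    threadLength A w u r = T ∧ tailLength A w u r = t := by
  obtain ⟨htail, htail_eq⟩ := tailLength_spec A w u r
  have hlength : threadLength A w u r = T := by
    apply le_antisymm
    · rw [threadLength_eq_sInf]
      exact Nat.sInf_le ⟨t, htT, h⟩
    · by_contra! hlt
      exact htail.ne (hinj (htail.trans hlt) hlt htail_eq)
  rw [hlength] at htail htail_eq
  exact ⟨hlength, hinj htail htT (htail_eq.trans h.symm)⟩

lemma reaches_iff {v : Fin n} {s : ZMod k} :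
    Reaches A w u r v s ↔ ∃ j, (explode A w)^[j] (u, r) = (v, s) := by
  have hthread : Reaches A w u r v s ↔
      ∃ j < threadLength A w u r, (explode A w)^[j] (u, r) = (v, s) := by
    simp [Reaches, thread, explode_iterate]
  refine hthread.trans ⟨fun ⟨j, _, h⟩ => ⟨j, h⟩, fun ⟨j, h⟩ => ?_⟩
  induction j using Nat.strong_induction_on with
  | _ j ih =>
    rcases lt_or_ge j (threadLength A w u r) with hj | hj
    · exact ⟨j, hj, h⟩
    · obtain ⟨htail, htail_eq⟩ := tailLength_spec A w u r
      refine ih (j - threadLength A w u r + tailLength A w u r) (by lia) ?_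
      rw [iterate_add_apply, htail_eq, ← iterate_add_apply, Nat.sub_add_cancel hj, h]

end Threads

section LowerRecords

variable {β : Type*} [LinearOrder β]

/-- The index `i` is a strict lower record of the sequence `s`. -/
def IsLowerRecord (s : ℕ → β) (i : ℕ) : Prop := ∀ j < i, s i < s j

open Classical in
/-- The last index up to `i` at which `s` has a lower record, that is, the position of the first
minimum of `s 0, …, s i`. -/
noncomputable def lastRecord (s : ℕ → β) (i : ℕ) : ℕ := Nat.findGreatest (IsLowerRecord s) i

/-- The indices up to `t` at which a block of `s` ends, the blocks being the intervals that start at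
the lower records of `s`. -/
def blockEnds (s : ℕ → β) (t : ℕ) : Set ℕ := {i | i ≤ t ∧ (i < t → IsLowerRecord s (i + 1))}

open Classical in
/-- The permutation of `{0, …, t}` whose cycles are the blocks of `s`. -/
noncomputable def recordCycle (s : ℕ → β) (t i : ℕ) : ℕ :=
  if i ∈ blockEnds s t then lastRecord s i else i + 1

variable (s : ℕ → β) {t i j : ℕ}

lemma isLowerRecord_zero : IsLowerRecord s 0 := fun _ hj => absurd hj (Nat.not_lt_zero _)

lemma lastRecord_le (i : ℕ) : lastRecord s i ≤ i := by
  classical exact Nat.findGreatest_le i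

lemma isLowerRecord_lastRecord (i : ℕ) : IsLowerRecord s (lastRecord s i) := by
  classical exact Nat.findGreatest_spec (Nat.zero_le i) (isLowerRecord_zero s)

variable {s} in
lemma IsLowerRecord.le_lastRecord (hj : IsLowerRecord s j) (hji : j ≤ i) : j ≤ lastRecord s i := by
  classical exact Nat.le_findGreatest hji hj

variable {s} in
lemma IsLowerRecord.lastRecord_eq (hi : IsLowerRecord s i) : lastRecord s i = i :=
  (lastRecord_le s i).antisymm (hi.le_lastRecord le_rfl)

variable {s} in
lemma lastRecord_succ_of_not_isLowerRecord (hi : ¬ IsLowerRecord s (i + 1)) :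
    lastRecord s (i + 1) = lastRecord s i := by
  classical exact Nat.findGreatest_of_not hi

lemma apply_lastRecord_le (hji : j ≤ i) : s (lastRecord s i) ≤ s j := by
  induction i generalizing j with
  | zero => rw [Nat.le_zero.1 hji, (isLowerRecord_zero s).lastRecord_eq]
  | succ i ih =>
    by_cases hi : IsLowerRecord s (i + 1)
    · rw [hi.lastRecord_eq]
      rcases hji.lt_or_eq with hlt | rfl
      exacts [(hi j hlt).le, le_rfl]
    · rw [lastRecord_succ_of_not_isLowerRecord hi]
      rcases hji.lt_or_eq with hlt | rfl
      · exact ih (by lia)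
      · simp only [IsLowerRecord, not_forall, not_lt] at hi
        obtain ⟨j, hj, hle⟩ := hi
        exact (ih (by lia)).trans hle

lemma notMem_blockEnds_iff (hi : i ≤ t) :
    i ∉ blockEnds s t ↔ i < t ∧ ¬ IsLowerRecord s (i + 1) := by
  rw [blockEnds, Set.mem_ofPred_eq]
  tauto

variable {s} in
lemma recordCycle_of_mem (h : i ∈ blockEnds s t) : recordCycle s t i = lastRecord s i := if_pos h

variable {s} in
lemma recordCycle_of_notMem (h : i ∉ blockEnds s t) : recordCycle s t i = i + 1 := if_neg h

lemma recordCycle_le (hi : i ≤ t) : recordCycle s t i ≤ t := by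
  by_cases h : i ∈ blockEnds s t
  · exact (recordCycle_of_mem h).trans_le ((lastRecord_le s i).trans hi)
  · exact (recordCycle_of_notMem h).trans_le ((notMem_blockEnds_iff s hi).1 h).1

lemma lastRecord_recordCycle (hi : i ≤ t) : lastRecord s (recordCycle s t i) = lastRecord s i := by
  by_cases h : i ∈ blockEnds s t
  · rw [recordCycle_of_mem h, (isLowerRecord_lastRecord s i).lastRecord_eq]
  · rw [recordCycle_of_notMem h,
      lastRecord_succ_of_not_isLowerRecord ((notMem_blockEnds_iff s hi).1 h).2]

lemma injOn_recordCycle (t : ℕ) : Set.InjOn (recordCycle s t) (Set.Iic t) := by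
  intro i hi j hj h
  wlog hij : i < j generalizing i j
  · rcases (not_lt.1 hij).lt_or_eq with hlt | heq
    exacts [(this hj hi h.symm hlt).symm, heq.symm]
  rw [Set.mem_Iic] at hi hj
  have hlast := congrArg (lastRecord s) h
  rw [lastRecord_recordCycle s hi, lastRecord_recordCycle s hj] at hlast
  have hi_last := lastRecord_le s i
  have hi_end : i ∉ blockEnds s t := fun hmem =>
    absurd ((hmem.2 (hij.trans_le hj)).le_lastRecord hij) (by lia)
  rw [recordCycle_of_notMem hi_end, recordCycle] at h
  split_ifs at h <;> lia

end LowerRecords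

section Foata

variable {α β : Type*} [LinearOrder β]

/-- `c 0, …, c t` enumerates `P` in such a way that `g` cyclically permutes each block of the
enumeration that starts at a lower record of the labels `σ` and ends before the next one: this is
Foata's correspondence between orderings and permutations. The values of `c` beyond `t`, which carry
no information, are fixed so that `c` is unique. -/
structure IsFoata (σ : α → β) (g : α → α) (P : Set α) (t : ℕ) (c : ℕ → α) : Prop where
  bijOn : Set.BijOn c (Set.Iic t) P
  map_eq : ∀ i ≤ t, g (c i) = c (recordCycle (σ ∘ c) t i)
  apply_of_ge : ∀ i ≥ t, c i = c t

namespace IsFoata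

variable {σ : α → β} {g : α → α} {P : Set α} {t t' i : ℕ} {c c' : ℕ → α}

lemma apply_succ_eq (h : IsFoata σ g P t c) (hi : i + 1 ≤ t)
    (hrec : ¬ IsLowerRecord (σ ∘ c) (i + 1)) : g (c i) = c (i + 1) := by
  rw [h.map_eq i (by lia), recordCycle_of_notMem fun hmem => hrec (hmem.2 hi)]

lemma exists_iterate_eq (h : IsFoata σ g P t c) (hi : i ≤ t) (m : ℕ) :
    ∃ j ≤ t, g^[m] (c i) = c j ∧ lastRecord (σ ∘ c) j = lastRecord (σ ∘ c) i := by
  induction m with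
  | zero => exact ⟨i, hi, rfl, rfl⟩
  | succ m ih =>
    obtain ⟨j, hj, hiter, hlast⟩ := ih
    refine ⟨_, recordCycle_le (σ ∘ c) hj, ?_, ?_⟩
    · rw [iterate_succ_apply', hiter, h.map_eq j hj]
    · rw [lastRecord_recordCycle _ hj, hlast]

lemma apply_lastRecord_le_iterate (h : IsFoata σ g P t c) (hi : i ≤ t) (m : ℕ) :
    σ (c (lastRecord (σ ∘ c) i)) ≤ σ (g^[m] (c i)) := by
  obtain ⟨j, _, hiter, hlast⟩ := h.exists_iterate_eq hi m
  rw [hiter, ← hlast]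
  exact apply_lastRecord_le (σ ∘ c) le_rfl

lemma exists_iterate_lastRecord_eq (h : IsFoata σ g P t c) (hi : i ≤ t) :
    ∃ m, g^[m] (c (lastRecord (σ ∘ c) i)) = c i := by
  induction i with
  | zero => exact ⟨0, by rw [(isLowerRecord_zero (σ ∘ c)).lastRecord_eq, iterate_zero_apply]⟩
  | succ i ih =>
    obtain ⟨m, hm⟩ := ih (by lia)
    by_cases hrec : IsLowerRecord (σ ∘ c) (i + 1)
    · exact ⟨0, by rw [hrec.lastRecord_eq, iterate_zero_apply]⟩
    · refine ⟨m + 1, ?_⟩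
      rw [lastRecord_succ_of_not_isLowerRecord hrec, iterate_succ_apply', hm,
        h.apply_succ_eq hi hrec]

/-! The new block that an enumeration starts at a record `i` is the one, among the cycles that have
not been enumerated yet, whose least label is largest; this determines `c i`. -/

lemma label_le_of_isLowerRecord (h : IsFoata σ g P t c) (h' : IsFoata σ g P t' c') (hi' : i ≤ t')
    (hagree : ∀ j < i, c j = c' j) (hrec' : IsLowerRecord (σ ∘ c') i) : σ (c' i) ≤ σ (c i) := by
  obtain ⟨j, hj : j ≤ t, hcj⟩ := h.bijOn.surjOn (h'.bijOn.mapsTo hi')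
  have hij : i ≤ j := by
    by_contra! hlt
    rw [hagree j hlt] at hcj
    exact hlt.ne (h'.bijOn.injOn (hlt.le.trans hi') hi' hcj)
  set a := lastRecord (σ ∘ c) j
  have haj : a ≤ j := lastRecord_le _ j
  obtain ⟨m, hm⟩ := h.exists_iterate_lastRecord_eq hj
  obtain ⟨b, hb : b ≤ t', hcb⟩ := h'.bijOn.surjOn (h.bijOn.mapsTo (haj.trans hj))
  obtain ⟨b', hb', hiter, hlast⟩ := h'.exists_iterate_eq hb m
  obtain rfl : i = b' := h'.bijOn.injOn hi' hb' <| by rw [← hiter, hcb, hm, hcj]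
  calc σ (c' i) = (σ ∘ c') (lastRecord (σ ∘ c') b) := by rw [← hlast, hrec'.lastRecord_eq]; rfl
    _ ≤ σ (c' b) := apply_lastRecord_le (σ ∘ c') le_rfl
    _ = (σ ∘ c) a := congrArg σ hcb
    _ ≤ σ (c i) := apply_lastRecord_le (σ ∘ c) hij

lemma isLowerRecord_of_isLowerRecord (h : IsFoata σ g P t c) (h' : IsFoata σ g P t' c')
    (hi : i ≤ t) (hi' : i ≤ t') (hagree : ∀ j < i, c j = c' j)
    (hrec : IsLowerRecord (σ ∘ c) i) : IsLowerRecord (σ ∘ c') i := by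
  cases i with
  | zero => exact isLowerRecord_zero _
  | succ i =>
    by_contra hrec'
    have hle : lastRecord (σ ∘ c) i ≤ i := lastRecord_le _ i
    have hend : i ∈ blockEnds (σ ∘ c) t := ⟨by lia, fun _ => hrec⟩
    have hmap : c' (i + 1) = c' (lastRecord (σ ∘ c) i) := by
      rw [← h'.apply_succ_eq hi' hrec', ← hagree i (by lia), h.map_eq i (by lia),
        recordCycle_of_mem hend, hagree _ (by lia)]
    have := h'.bijOn.injOn hi' (show lastRecord (σ ∘ c) i ≤ t' by lia) hmap
    lia

lemma apply_eq_of_le (hσ : Injective σ) (h : IsFoata σ g P t c) (h' : IsFoata σ g P t' c')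
    (hi : i ≤ t) (hi' : i ≤ t') : c i = c' i := by
  induction i using Nat.strong_induction_on with
  | _ i ih =>
    have hagree : ∀ j < i, c j = c' j := fun j hj => ih j hj (by lia) (by lia)
    have hagree' : ∀ j < i, c' j = c j := fun j hj => (hagree j hj).symm
    by_cases hrec : IsLowerRecord (σ ∘ c) i
    · have hrec' := h.isLowerRecord_of_isLowerRecord h' hi hi' hagree hrec
      exact hσ <| (h'.label_le_of_isLowerRecord h hi hagree' hrec).antisymm
        (h.label_le_of_isLowerRecord h' hi' hagree hrec')
    · have hrec' : ¬ IsLowerRecord (σ ∘ c') i := fun hrec' =>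
        hrec (h'.isLowerRecord_of_isLowerRecord h hi' hi hagree' hrec')
      cases i with
      | zero => exact absurd (isLowerRecord_zero _) hrec
      | succ i =>
        rw [← h.apply_succ_eq hi hrec, hagree i (by lia), h'.apply_succ_eq hi' hrec']

lemma unique (hσ : Injective σ) (h : IsFoata σ g P t c) (h' : IsFoata σ g P t' c') :
    t = t' ∧ c = c' := by
  have hcard := h.bijOn.injOn.ncard_image
  rw [h.bijOn.image_eq, ← h'.bijOn.image_eq, h'.bijOn.injOn.ncard_image] at hcard
  obtain rfl : t = t' := by simpa using hcard.symm
  refine ⟨rfl, funext fun i => ?_⟩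
  rcases le_total i t with hi | hi
  · exact h.apply_eq_of_le hσ h' hi hi
  · rw [h.apply_of_ge i hi, h'.apply_of_ge i hi, h.apply_eq_of_le hσ h' le_rfl le_rfl]

end IsFoata

/-- The enumeration of a type by natural numbers that is attached to an ordering `e`; beyond the
last index it is constant. -/
def orderingSeq {C : Type*} {t : ℕ} (e : Fin (t + 1) ≃ C) (i : ℕ) : C :=
  e ⟨min i t, by lia⟩

lemma bijOn_orderingSeq {C : Type*} {t : ℕ} (e : Fin (t + 1) ≃ C) :
    Set.BijOn (orderingSeq e) (Set.Iic t) Set.univ := by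
  refine ⟨fun _ _ => trivial, fun i hi j hj h => ?_, fun x _ => ?_⟩
  · have hmin := e.injective h
    rw [Set.mem_Iic] at hi hj
    rwa [Fin.mk.injEq, min_eq_left hi, min_eq_left hj] at hmin
  · have hx := Nat.lt_succ_iff.1 (e.symm x).2
    exact ⟨e.symm x, hx, by simp [orderingSeq, min_eq_left hx]⟩

lemma exists_perm_isFoata_orderingSeq {C : Type*} {t : ℕ} (σ : C → β) (e : Fin (t + 1) ≃ C) :
    ∃ g : Equiv.Perm C, IsFoata σ g Set.univ t (orderingSeq e) := by
  have : Finite C := Finite.of_equiv _ e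
  set c := orderingSeq e
  have hle (x : C) : (e.symm x : ℕ) ≤ t := Nat.lt_succ_iff.1 (e.symm x).2
  let f (x : C) : C := c (recordCycle (σ ∘ c) t (e.symm x))
  have hf : Injective f := fun x y h => by
    have hcycle := (bijOn_orderingSeq e).injOn (recordCycle_le _ (hle x))
      (recordCycle_le _ (hle y)) h
    exact e.symm.injective (Fin.ext (injOn_recordCycle _ t (hle x) (hle y) hcycle))
  refine ⟨Equiv.ofBijective f hf.bijective_of_finite, bijOn_orderingSeq e, fun i hi => ?_,
    fun i hi => ?_⟩
  · simp [f, c, orderingSeq, min_eq_left hi]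
  · simp [c, orderingSeq, min_eq_right hi]

lemma exists_isFoata_perm {C : Type*} [Finite C] [Nonempty C] {σ : C → β} (hσ : Injective σ)
    (g : Equiv.Perm C) : ∃ t c, IsFoata σ g Set.univ t c := by
  classical
  have := Fintype.ofFinite C
  obtain ⟨t, ht⟩ : ∃ t, Fintype.card C = t + 1 :=
    Nat.exists_eq_succ_of_ne_zero Fintype.card_ne_zero
  -- By uniqueness, orderings inject into permutations, and there are equally many of both.
  choose F hF using fun e : Fin (t + 1) ≃ C => exists_perm_isFoata_orderingSeq σ e
  have hF_inj : Injective F := by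
    intro e e' h
    ext i
    have hi := Nat.lt_succ_iff.1 i.2
    have heq := (hF e).apply_eq_of_le hσ (h ▸ hF e') hi hi
    simpa [orderingSeq, min_eq_left hi] using heq
  have e₀ : Fin (t + 1) ≃ C := (Fintype.equivFinOfCardEq ht).symm
  have hcard : Fintype.card (Fin (t + 1) ≃ C) = Fintype.card (Equiv.Perm C) := by
    rw [Fintype.card_equiv e₀, Fintype.card_perm, ht, Fintype.card_fin]
  obtain ⟨e, rfl⟩ := ((Fintype.bijective_iff_injective_and_card F).2 ⟨hF_inj, hcard⟩).2 g
  exact ⟨t, orderingSeq e, hF e⟩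

lemma exists_isFoata {σ : α → β} (hσ : Injective σ) {g : α → α} {P : Set α} (hfin : P.Finite)
    (hP : P.Nonempty) (hg : Set.BijOn g P P) : ∃ t c, IsFoata σ g P t c := by
  have := hfin.to_subtype
  have := hP.to_subtype
  obtain ⟨t, c, h⟩ := exists_isFoata_perm (σ := fun x : P => σ x)
    (hσ.comp Subtype.val_injective) (Set.BijOn.equiv g hg)
  refine ⟨t, fun i => c i, ⟨?_, fun i hi => congrArg Subtype.val (h.map_eq i hi),
    fun i hi => congrArg Subtype.val (h.apply_of_ge i hi)⟩⟩
  have hval : Set.BijOn Subtype.val Set.univ P :=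
    ⟨fun x _ => x.2, Subtype.val_injective.injOn, fun x hx => ⟨⟨x, hx⟩, trivial, rfl⟩⟩
  exact hval.comp h.bijOn

end Foata

section Rewiring

variable {n k : ℕ} {A₁ A₂ A₃ : Automaton n} {w : Word k} {S : Set (Fin n)}

/-- From a vertex of `S`, whatever the congruence one starts with, one comes back to `S` only with
congruence `0`. -/
def ReturnsAtZero (A : Automaton n) (w : Word k) (S : Set (Fin n)) : Prop :=
  ∀ o : Fin n × ZMod k, o.1 ∈ S → ∀ j ≥ 1,
    ((explode A w)^[j] o).1 ∈ S → ((explode A w)^[j] o).2 = 0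

/-- `A₁` and `A₂` differ only at transitions that end in `S` in both automata. -/
def AgreeOutside (A₁ A₂ : Automaton n) (S : Set (Fin n)) : Prop :=
  ∀ l u, A₁ l u ≠ A₂ l u → A₁ l u ∈ S ∧ A₂ l u ∈ S

lemma ReturnsAtZero.mono {S' : Set (Fin n)} (hret : ReturnsAtZero A₁ w S) (h : S' ⊆ S) :
    ReturnsAtZero A₁ w S' :=
  fun o ho j hj hj' => hret o (h ho) j hj (h hj')

namespace AgreeOutside

lemma symm (h : AgreeOutside A₁ A₂ S) : AgreeOutside A₂ A₁ S :=
  fun l u hne => (h l u hne.symm).symm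

lemma explode_eq (h : AgreeOutside A₁ A₂ S) {o : Fin n × ZMod k}
    (ho : (explode A₁ w o).1 ∉ S) : explode A₂ w o = explode A₁ w o := by
  by_contra hne
  exact ho (h (w (o.2 + 1)) o.1 fun heq => hne (Prod.ext heq.symm rfl)).1

lemma explode_mem (h : AgreeOutside A₁ A₂ S) {o : Fin n × ZMod k}
    (ho : (explode A₁ w o).1 ∈ S) : (explode A₂ w o).1 ∈ S := by
  by_cases heq : A₁ (w (o.2 + 1)) o.1 = A₂ (w (o.2 + 1)) o.1
  · exact (congrArg (· ∈ S) heq).mp ho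
  · exact (h _ _ heq).2

lemma iterate_eq (h : AgreeOutside A₁ A₂ S) (o : Fin n × ZMod k) (j : ℕ)
    (hj : ∀ i < j, ((explode A₁ w)^[i + 1] o).1 ∉ S) :
    (explode A₂ w)^[j] o = (explode A₁ w)^[j] o := by
  induction j with
  | zero => rfl
  | succ j ih =>
    have hlast := hj j (by lia)
    rw [iterate_succ_apply'] at hlast
    rw [iterate_succ_apply', ih fun i hi => hj i (by lia), iterate_succ_apply',
      h.explode_eq hlast]

lemma exists_first_visit (h : AgreeOutside A₁ A₂ S) (o : Fin n × ZMod k) {j : ℕ} (hj : 1 ≤ j)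
    (hjS : ((explode A₁ w)^[j] o).1 ∈ S) :
    ∃ i, 1 ≤ i ∧ i ≤ j ∧ ((explode A₁ w)^[i] o).1 ∈ S ∧ ((explode A₂ w)^[i] o).1 ∈ S := by
  classical
  have hex : ∃ i, ((explode A₁ w)^[i + 1] o).1 ∈ S := ⟨j - 1, by rwa [Nat.sub_add_cancel hj]⟩
  have hfirst := Nat.find_spec hex
  refine ⟨Nat.find hex + 1, by lia, ?_, hfirst, ?_⟩
  · have := Nat.find_min' hex (m := j - 1) (by rwa [Nat.sub_add_cancel hj])
    lia
  · rw [iterate_succ_apply'] at hfirst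
    rw [iterate_succ_apply', h.iterate_eq o _ fun i hi => Nat.find_min hex hi]
    exact h.explode_mem hfirst

end AgreeOutside

namespace ReturnsAtZero

lemma of_agreeOutside (hret : ReturnsAtZero A₁ w S) (h : AgreeOutside A₁ A₂ S) :
    ReturnsAtZero A₂ w S := by
  intro o ho j hj hjS
  induction j using Nat.strong_induction_on generalizing o with
  | _ j ih =>
    obtain ⟨i, hi, hij, hiS₂, hiS₁⟩ := h.symm.exists_first_visit o hj hjS
    rcases hij.lt_or_eq with hlt | rfl
    · have hrest := ih (j - i) (by lia) ((explode A₂ w)^[i] o) hiS₂ (by lia)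
      rw [← iterate_add_apply, Nat.sub_add_cancel hij] at hrest
      exact hrest hjS
    · have hzero := hret o ho i hi hiS₁
      rwa [explode_iterate_snd] at hzero ⊢

lemma exists_iterate_eq (hret : ReturnsAtZero A₁ w S) (h : AgreeOutside A₁ A₂ S)
    (hall : ∀ o, ∃ j, ((explode A₁ w)^[j] o).1 ∈ S) (o : Fin n × ZMod k) :
    ∃ j, ∃ b ∈ S, (explode A₂ w)^[j] o = (b, 0) := by
  have hvisit (o) : ∃ i ≥ 1, ((explode A₁ w)^[i] o).1 ∈ S ∧ ((explode A₂ w)^[i] o).1 ∈ S := by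
    obtain ⟨j, hj⟩ := hall (explode A₁ w o)
    obtain ⟨i, hi, -, hiS⟩ := h.exists_first_visit o (j := j + 1) (by lia) hj
    exact ⟨i, hi, hiS⟩
  obtain ⟨i, -, -, hiS⟩ := hvisit o
  obtain ⟨i', hi', hiS₁, hiS₂⟩ := hvisit ((explode A₂ w)^[i] o)
  have hzero := hret _ hiS i' hi' hiS₁
  refine ⟨i' + i, _, hiS₂, ?_⟩
  rw [iterate_add_apply]
  rw [explode_iterate_snd] at hzero
  exact Prod.ext rfl (by rw [explode_iterate_snd, hzero])

lemma iterate_eq_of_lt (hret : ReturnsAtZero A₁ w S) (h : AgreeOutside A₁ A₂ S) {x : Fin n}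
    (hx : x ∈ S) (m : ℕ) {b : ℕ} (hb : b < k) :
    (explode A₂ w)^[b] ((inducedMap A₁ w)^[m] x, 0) =
      (explode A₁ w)^[b] ((inducedMap A₁ w)^[m] x, 0) := by
  refine h.iterate_eq _ _ fun i hi hiS => ?_
  rw [← explode_iterate_mul, ← iterate_add_apply] at hiS
  have hzero := hret (x, 0) hx _ (by lia) hiS
  rw [explode_iterate_snd, zero_add, ZMod.natCast_eq_zero_iff,
    ← Nat.dvd_add_iff_left (Dvd.intro m rfl)] at hzero
  exact absurd (Nat.le_of_dvd (by lia) hzero) (by lia)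

end ReturnsAtZero

lemma inducedMap_eq [NeZero k] (A : Automaton n) (w : Word k) (u : Fin n) :
    inducedMap A w u = A (w 0) (walk A w u 0 (k - 1)) := by
  obtain ⟨m, rfl⟩ := Nat.exists_eq_succ_of_ne_zero (NeZero.ne k)
  have hzero : (0 : ZMod (m + 1)) + m + 1 = 0 := by
    rw [zero_add, ← Nat.cast_succ, ZMod.natCast_self]
  rw [inducedMap, walk_succ, hzero, Nat.add_one_sub_one]

/-- `A₂` is obtained from `A₁` by redirecting, for `i ∈ E`, the last transition of the
`w`-transition of `c i`; the redirections do not affect the first `k - 1` transitions. -/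
structure IsRedirection (w : Word k) (E : Set ℕ) (c : ℕ → Fin n) (A₁ A₂ : Automaton n) :
    Prop where
  walk_eq : ∀ i ∈ E, walk A₂ w (c i) 0 (k - 1) = walk A₁ w (c i) 0 (k - 1)
  eq_off : ∀ l u, (∀ i ∈ E, (l, u) ≠ (w 0, walk A₁ w (c i) 0 (k - 1))) → A₁ l u = A₂ l u

variable {E : Set ℕ} {c : ℕ → Fin n}

lemma IsRedirection.symm (h : IsRedirection w E c A₁ A₂) : IsRedirection w E c A₂ A₁ where
  walk_eq i hi := (h.walk_eq i hi).symm
  eq_off l u hlu := (h.eq_off l u fun i hi => h.walk_eq i hi ▸ hlu i hi).symm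

lemma IsRedirection.unique [NeZero k] (h₂ : IsRedirection w E c A₁ A₂)
    (h₃ : IsRedirection w E c A₁ A₃)
    (heq : ∀ i ∈ E, inducedMap A₂ w (c i) = inducedMap A₃ w (c i)) : A₂ = A₃ := by
  funext l u
  by_cases hlu : ∃ i ∈ E, (l, u) = (w 0, walk A₁ w (c i) 0 (k - 1))
  · obtain ⟨i, hi, hlu⟩ := hlu
    obtain ⟨rfl, rfl⟩ := Prod.mk.inj hlu
    have hend := heq i hi
    rwa [inducedMap_eq, inducedMap_eq, h₂.walk_eq i hi, h₃.walk_eq i hi] at hend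
  · push Not at hlu
    rw [← h₂.eq_off l u hlu, h₃.eq_off l u hlu]

lemma exists_eq_on_of_injOn {edge : ℕ → Letter × Fin n} (A : Automaton n)
    (hinj : Set.InjOn edge E) (next : ℕ → Fin n) :
    ∃ A' : Automaton n, (∀ i ∈ E, A' (edge i).1 (edge i).2 = next i) ∧
      ∀ l u, (∀ i ∈ E, (l, u) ≠ edge i) → A l u = A' l u := by
  let g := extend (E.domRestrict edge) (E.domRestrict next) (uncurry A)
  refine ⟨curry g, fun i hi => ?_, fun l u h => ?_⟩
  · exact hinj.injective.extend_apply _ _ (⟨i, hi⟩ : E)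
  · refine (extend_apply' (f := E.domRestrict edge) _ (uncurry A) (l, u) ?_).symm
    rintro ⟨⟨i, hi⟩, heq⟩
    exact h i hi heq.symm

lemma exists_isRedirection [NeZero k] {t : ℕ} {next : ℕ → Fin n} (hret : ReturnsAtZero A₁ w S)
    (hinj : Set.InjOn (fun i => walk A₁ w (c i) 0 (k - 1)) (Set.Iic t))
    (hreach : ∀ i ≤ t, ∃ x ∈ S, ∃ m, (inducedMap A₁ w)^[m] x = c i)
    (hE : ∀ i ∈ E, i ≤ t ∧ inducedMap A₁ w (c i) ∈ S ∧ next i ∈ S)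
    (hnext : ∀ i ≤ t, i ∉ E → next i = inducedMap A₁ w (c i)) :
    ∃ A₂, IsRedirection w E c A₁ A₂ ∧ AgreeOutside A₁ A₂ S ∧
      (∀ i ≤ t, ∀ b < k, (explode A₂ w)^[b] (c i, 0) = (explode A₁ w)^[b] (c i, 0)) ∧
      ∀ i ≤ t, inducedMap A₂ w (c i) = next i := by
  have hedge : Set.InjOn (fun i => (w 0, walk A₁ w (c i) 0 (k - 1))) E := fun i hi j hj h =>
    hinj (hE i hi).1 (hE j hj).1 (congrArg Prod.snd h)
  obtain ⟨A₂, hon, hoff⟩ := exists_eq_on_of_injOn A₁ hedge next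
  have hagree : AgreeOutside A₁ A₂ S := by
    intro l u hne
    obtain ⟨i, hi, hlu⟩ : ∃ i ∈ E, (l, u) = (w 0, walk A₁ w (c i) 0 (k - 1)) := by
      by_contra! h
      exact hne (hoff l u h)
    obtain ⟨rfl, rfl⟩ := Prod.mk.inj hlu
    rw [hon i hi, ← inducedMap_eq A₁]
    exact (hE i hi).2
  have hiter (i) (hi : i ≤ t) (b) (hb : b < k) :
      (explode A₂ w)^[b] (c i, 0) = (explode A₁ w)^[b] (c i, 0) := by
    obtain ⟨x, hx, m, hm⟩ := hreach i hi
    rw [← hm, hret.iterate_eq_of_lt hagree hx m hb]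
  have hwalk (i) (hi : i ≤ t) : walk A₂ w (c i) 0 (k - 1) = walk A₁ w (c i) 0 (k - 1) := by
    have h := hiter i hi (k - 1) (Nat.sub_one_lt (NeZero.ne k))
    rw [explode_iterate, explode_iterate] at h
    exact congrArg Prod.fst h
  refine ⟨A₂, ⟨fun i hi => hwalk i (hE i hi).1, hoff⟩, hagree, hiter, fun i hi => ?_⟩
  rw [inducedMap_eq, hwalk i hi]
  by_cases hiE : i ∈ E
  · exact hon i hiE
  · rw [hnext i hi hiE, inducedMap_eq, ← hoff]
    intro j hj hlu
    exact hiE (hinj hi (hE j hj).1 (congrArg Prod.snd hlu) ▸ hj)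

end Rewiring

section Branches

variable {n k : ℕ}

/-- The values of `c` at the lower records of `s` up to `t`, and at `t`. For the branch `c` of a
marked tree and `s = σ ∘ c`, these are the vertices `b₁, …, b_{ℓ+1}`. -/
def recordVertices {α β : Type*} [LinearOrder β] (s : ℕ → β) (t : ℕ) (c : ℕ → α) : Set α :=
  c '' {i | i ≤ t ∧ (IsLowerRecord s i ∨ i = t)}

section RecordVertices

variable {α β : Type*} [LinearOrder β] {s : ℕ → β} {t i : ℕ} {c : ℕ → α}

lemma apply_lastRecord_mem_recordVertices (hi : i ≤ t) :
    c (lastRecord s i) ∈ recordVertices s t c :=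
  ⟨_, ⟨(lastRecord_le s i).trans hi, Or.inl (isLowerRecord_lastRecord s i)⟩, rfl⟩

lemma apply_last_mem_recordVertices : c t ∈ recordVertices s t c := ⟨t, ⟨le_rfl, Or.inr rfl⟩, rfl⟩

lemma apply_succ_mem_recordVertices (hc : ∀ i ≥ t, c i = c t) (hi : i ∈ blockEnds s t) :
    c (i + 1) ∈ recordVertices s t c := by
  rcases hi.1.lt_or_eq with hlt | rfl
  · exact ⟨i + 1, ⟨hlt, Or.inl (hi.2 hlt)⟩, rfl⟩
  · exact hc (i + 1) (Nat.le_succ i) ▸ apply_last_mem_recordVertices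

lemma apply_recordCycle_mem_recordVertices (hi : i ∈ blockEnds s t) :
    c (recordCycle s t i) ∈ recordVertices s t c := by
  rw [recordCycle_of_mem hi]
  exact apply_lastRecord_mem_recordVertices hi.1

end RecordVertices

/-- The data of a branch-good `0`-shifted marked `w`-tree `(A, c 0, σ)`: the branch `c` of the
marked vertex, which reaches the root at time `t`. -/
structure IsGoodBranch (A : Automaton n) (w : Word k) (σ : Equiv.Perm (Fin n)) (t : ℕ)
    (c : ℕ → Fin n) : Prop where
  map_eq : ∀ i, inducedMap A w (c i) = c (i + 1)
  apply_of_ge : ∀ i ≥ t, c i = c t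
  injOn : Set.InjOn (fun i => (explode A w)^[i] (c 0, 0)) (Set.Iio (k * (t + 1)))
  exists_iterate_eq : ∀ o, ∃ j, (explode A w)^[j] o = (c t, 0)
  returnsAtZero : ReturnsAtZero A w (recordVertices (σ ∘ c) t c)

variable {A A' : Automaton n} {w : Word k} {σ : Equiv.Perm (Fin n)} {v : Fin n} {t : ℕ}
  {c : ℕ → Fin n}

namespace IsGoodBranch

lemma iterate_inducedMap_eq (h : IsGoodBranch A w σ t c) (i : ℕ) :
    (inducedMap A w)^[i] (c 0) = c i := by
  rw [iterate_apply_of_forall_apply_eq_succ h.map_eq, zero_add]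

lemma isWTree (h : IsGoodBranch A w σ t c) : IsWTree A w := by
  have hfix : IsFixedPt (inducedMap A w) (c t) := by
    rw [IsFixedPt, h.map_eq, h.apply_of_ge _ (Nat.le_succ t)]
  refine ⟨c t, ⟨1, one_pos, hfix.iterate 1⟩, fun x hx => ?_⟩
  obtain ⟨j, hj⟩ := h.exists_iterate_eq (x, 0)
  obtain ⟨m, hm⟩ := exists_iterate_inducedMap_eq hj
  obtain ⟨l, hl⟩ := exists_iterate_iterate_eq_of_mem_periodicPts hx m
  rw [← hl, hm, iterate_fixed hfix]

end IsGoodBranch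

/-- Cutting the branch `c` of `A` at its lower records and closing the blocks to cycles gives `A'`;
conversely, `A` is obtained by concatenating the cycles of `A'` in the order of Foata's
correspondence. -/
structure IsCutting (w : Word k) (σ : Equiv.Perm (Fin n)) (t : ℕ) (c : ℕ → Fin n)
    (A A' : Automaton n) : Prop where
  map_eq : ∀ i, inducedMap A w (c i) = c (i + 1)
  isFoata : IsFoata σ (inducedMap A' w) (periodicPts (inducedMap A' w)) t c
  isRedirection : IsRedirection w (blockEnds (σ ∘ c) t) c A A'

lemma IsCutting.length_le {t' : ℕ} {B' : Automaton n} (h : IsCutting w σ t c A A')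
    (h' : IsCutting w σ t' c A B') : t ≤ t' := by
  by_contra! hlt
  exact t'.succ_ne_self
    (h.isFoata.bijOn.injOn hlt hlt.le (h'.isFoata.apply_of_ge _ (Nat.le_succ t')))

variable [NeZero k]

lemma mem_branchVertices_iff (ht : tailLength A w v 0 = k * t)
    (hc : ∀ i, walk A w v 0 (k * i) = c i) (x : Fin n) :
    x ∈ branchVertices A w v σ ↔ x ∈ recordVertices (σ ∘ c) t c := by
  simp only [branchVertices, lowerRecords, ht, hc, Nat.mul_div_cancel_left t (NeZero.pos k),
    List.mem_append, List.mem_map, List.mem_filter, List.mem_range, List.mem_singleton,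
    decide_eq_true_eq, Nat.lt_succ_iff, recordVertices, Set.mem_image, Set.mem_ofPred_eq,
    IsLowerRecord, comp_apply]
  aesop

lemma IsBranchGood.returnsAtZero (h : IsBranchGood A w v σ) (ht : tailLength A w v 0 = k * t)
    (hc : ∀ i, walk A w v 0 (k * i) = c i) (hroot : ∀ o, ∃ j, (explode A w)^[j] o = (c t, 0)) :
    ReturnsAtZero A w (recordVertices (σ ∘ c) t c) := by
  simp only [IsBranchGood, mem_branchVertices_iff ht hc, reaches_iff] at h
  rintro ⟨x, r⟩ hx j hj hjS
  by_cases hloop : (explode A w)^[j] (x, r) = (x, r)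
  · -- The root reaches `(x, r)` back, and it is reached with congruence `0`.
    obtain ⟨m, hm⟩ := hroot (x, r)
    obtain ⟨l, hl⟩ := exists_iterate_iterate_eq_of_mem_periodicPts ⟨j, hj, hloop⟩ m
    rw [hm] at hl
    rw [hloop]
    by_contra hr
    exact hr (h _ apply_last_mem_recordVertices x hx 0 r (fun heq => hr (congrArg Prod.snd heq))
      ⟨l, hl⟩)
  · exact h x hx _ hjS r _ hloop ⟨j, rfl⟩

lemma ReturnsAtZero.isBranchGood (h : ReturnsAtZero A w (recordVertices (σ ∘ c) t c))
    (ht : tailLength A w v 0 = k * t) (hc : ∀ i, walk A w v 0 (k * i) = c i) :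
    IsBranchGood A w v σ := by
  simp only [IsBranchGood, mem_branchVertices_iff ht hc, reaches_iff]
  rintro x hx y hy r s hne ⟨j, hj⟩
  have hpos : 1 ≤ j := Nat.one_le_iff_ne_zero.2 fun h0 => hne (by rw [← hj, h0]; rfl)
  have hzero := h (x, r) hx j hpos
  rw [hj] at hzero
  exact hzero hy

lemma exists_isGoodBranch (h : (A, v, σ) ∈ goodMarkedTrees n w) :
    ∃ t c, IsGoodBranch A w σ t c ∧ c 0 = v := by
  obtain ⟨hgood, ⟨z, hz, huniq⟩, -, hshift⟩ := h
  dsimp only at hgood hz huniq hshift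
  obtain ⟨hlt, heq⟩ := tailLength_spec A w v 0
  have hinj := injOn_explode_iterate_threadLength A w v 0
  obtain ⟨T, hT⟩ := (ZMod.natCast_eq_zero_iff _ _).1 hshift
  obtain ⟨t, ht⟩ : k ∣ tailLength A w v 0 :=
    (((explode_iterate_eq_iff A w v 0 _ _).1 heq).2.dvd_iff dvd_rfl).2 ⟨T, hT⟩
  rw [ht, hT, mul_lt_mul_iff_right₀ (NeZero.pos k)] at hlt
  rw [ht, hT, explode_iterate_mul, explode_iterate_mul] at heq
  have hroot : (inducedMap A w)^[t] v = z := by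
    refine huniq _ ⟨T - t, by lia, ?_⟩
    rw [IsPeriodicPt, IsFixedPt, ← iterate_add_apply, Nat.sub_add_cancel hlt.le]
    exact (congrArg Prod.fst heq).symm
  have hfix : IsFixedPt (inducedMap A w) z := huniq _ ((bijOn_periodicPts _).mapsTo hz)
  have hwalk (i) : walk A w v 0 (k * i) = (inducedMap A w)^[i] v := walk_mul A w v i
  have hreach (o) : ∃ j, (explode A w)^[j] o = ((inducedMap A w)^[t] v, 0) := by
    obtain ⟨j, u, hu, hj⟩ := exists_explode_iterate_mem_periodicPts A w o
    exact ⟨j, by rw [hj, huniq u hu, hroot]⟩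
  refine ⟨t, fun i => (inducedMap A w)^[i] v, ⟨fun i => (iterate_succ_apply' _ _ _).symm,
    fun i hi => ?_, hinj.mono ?_, hreach, hgood.returnsAtZero ht hwalk hreach⟩, rfl⟩
  · rw [← Nat.sub_add_cancel hi, iterate_add_apply, hroot, iterate_fixed hfix]
  · rw [hT, Set.Iio_subset_Iio_iff]
    exact Nat.mul_le_mul_left k hlt

namespace IsGoodBranch

lemma mem_goodMarkedTrees (h : IsGoodBranch A w σ t c) : (A, c 0, σ) ∈ goodMarkedTrees n w := by
  obtain ⟨hlength, htail⟩ := threadLength_eq_and_tailLength_eq (t := k * t)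
    (Nat.mul_lt_mul_of_pos_left (Nat.lt_succ_self t) (NeZero.pos k)) (by
      rw [explode_iterate_mul, explode_iterate_mul, h.iterate_inducedMap_eq,
        h.iterate_inducedMap_eq, h.apply_of_ge _ (Nat.le_succ t)]) h.injOn
  have hwalk (i) : walk A w (c 0) 0 (k * i) = c i := by rw [walk_mul, h.iterate_inducedMap_eq]
  exact ⟨h.returnsAtZero.isBranchGood htail hwalk, h.isWTree, h.isWTree,
    (ZMod.natCast_eq_zero_iff _ _).2 ⟨_, hlength⟩⟩

lemma injOn_walk (h : IsGoodBranch A w σ t c) :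
    Set.InjOn (fun i => walk A w (c i) 0 (k - 1)) (Set.Iic t) := by
  have hk : k - 1 < k := Nat.sub_one_lt (NeZero.ne k)
  have hlt (i) (hi : i ∈ Set.Iic t) : k - 1 + k * i ∈ Set.Iio (k * (t + 1)) := by
    have := Nat.mul_le_mul_left k (Set.mem_Iic.1 hi)
    rw [Set.mem_Iio, mul_add]
    lia
  intro i hi j hj hij
  have heq := h.injOn (hlt i hi) (hlt j hj) <| by
    simp only [iterate_add_apply, explode_iterate_mul, h.iterate_inducedMap_eq]
    simp only [explode_iterate, hij]
  exact Nat.eq_of_mul_eq_mul_left (NeZero.pos k) (Nat.add_left_cancel heq)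

end IsGoodBranch

lemma IsGoodBranch.exists_isCutting (h : IsGoodBranch A w σ t c) :
    ∃ A', IsCutting w σ t c A A' := by
  set s := σ ∘ c
  obtain ⟨A', hred, hagree, -, hmap⟩ := exists_isRedirection (E := blockEnds s t)
    (next := fun i => c (recordCycle s t i)) h.returnsAtZero h.injOn_walk
    (fun i _ => ⟨c 0, ⟨0, ⟨Nat.zero_le t, Or.inl (isLowerRecord_zero s)⟩, rfl⟩, i,
      h.iterate_inducedMap_eq i⟩)
    (fun i hi => ⟨hi.1, h.map_eq i ▸ apply_succ_mem_recordVertices h.apply_of_ge hi,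
      apply_recordCycle_mem_recordVertices hi⟩)
    (fun i _ hi => by rw [recordCycle_of_notMem hi, h.map_eq])
  have hinj : Set.InjOn c (Set.Iic t) := fun i hi j hj hij =>
    h.injOn_walk hi hj (congrArg (walk A w · 0 (k - 1)) hij)
  have hmaps : Set.MapsTo (inducedMap A' w) (c '' Set.Iic t) (c '' Set.Iic t) := by
    rintro _ ⟨i, hi, rfl⟩
    exact ⟨_, recordCycle_le s hi, (hmap i hi).symm⟩
  have hinj' : Set.InjOn (inducedMap A' w) (c '' Set.Iic t) := by
    rintro _ ⟨i, hi, rfl⟩ _ ⟨j, hj, rfl⟩ hij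
    rw [hmap i hi, hmap j hj] at hij
    rw [injOn_recordCycle s t hi hj (hinj (recordCycle_le s hi) (recordCycle_le s hj) hij)]
  have hper : periodicPts (inducedMap A' w) = c '' Set.Iic t := by
    refine periodicPts_eq_of_injOn (Set.toFinite _) hmaps hinj' fun x _ => ?_
    obtain ⟨j, _, ⟨i, ⟨hi, -⟩, rfl⟩, hj⟩ := h.returnsAtZero.exists_iterate_eq hagree (fun o => by
      obtain ⟨j, hj⟩ := h.exists_iterate_eq o
      exact ⟨j, hj ▸ apply_last_mem_recordVertices⟩) (x, 0)
    obtain ⟨m, hm⟩ := exists_iterate_inducedMap_eq hj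
    exact ⟨m, i, hi, hm.symm⟩
  exact ⟨A', h.map_eq, ⟨hper ▸ hinj.bijOn_image, hmap, h.apply_of_ge⟩, hred⟩

namespace IsCutting

lemma eq_of_right {t' : ℕ} {c' : ℕ → Fin n} {B : Automaton n} (h : IsCutting w σ t c A A')
    (h' : IsCutting w σ t' c' B A') : c = c' ∧ A = B := by
  obtain ⟨rfl, rfl⟩ := h.isFoata.unique σ.injective h'.isFoata
  exact ⟨rfl, h.isRedirection.symm.unique h'.isRedirection.symm fun i _ => by
    rw [h.map_eq, h'.map_eq]⟩

lemma eq_of_left {t' : ℕ} {c' : ℕ → Fin n} {B' : Automaton n} (h : IsCutting w σ t c A A')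
    (h' : IsCutting w σ t' c' A B') (h0 : c 0 = c' 0) : A' = B' := by
  obtain rfl : c = c' := funext fun i => by
    have hi := iterate_apply_of_forall_apply_eq_succ h.map_eq 0 i
    rwa [h0, iterate_apply_of_forall_apply_eq_succ h'.map_eq, zero_add, eq_comm] at hi
  obtain rfl : t = t' := (h.length_le h').antisymm (h'.length_le h)
  exact h.isRedirection.unique h'.isRedirection fun i hi => by
    rw [h.isFoata.map_eq i hi.1, h'.isFoata.map_eq i hi.1]

end IsCutting

lemma ncard_le_ncard_of_forall_exists {α β : Type*} [Finite α] [Finite β] {S : Set α} {S' : Set β}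
    (R : α → β → Prop) (hex : ∀ a ∈ S, ∃ b ∈ S', R a b)
    (huniq : ∀ a a' b, R a b → R a' b → a = a') : S.ncard ≤ S'.ncard := by
  classical
  have := Fintype.ofFinite α
  have := Fintype.ofFinite β
  rw [Set.ncard_eq_toFinset_card', Set.ncard_eq_toFinset_card']
  refine Finset.card_le_card_of_forall_subsingleton R (by simpa using hex) ?_
  rintro b - a ⟨-, ha⟩ a' ⟨-, ha'⟩
  exact huniq a a' b ha ha'

lemma ncard_goodMarkedTrees_le (w : Word k) :
    (goodMarkedTrees n w).ncard ≤ Nat.card (Automaton n × Equiv.Perm (Fin n)) := by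
  rw [← Set.ncard_univ]
  refine ncard_le_ncard_of_forall_exists
    (fun x y => y.2 = x.2.2 ∧ ∃ t c, IsCutting w x.2.2 t c x.1 y.1 ∧ c 0 = x.2.1) ?_ ?_
  · rintro ⟨A, v, σ⟩ h
    obtain ⟨t, c, hbranch, hv⟩ := exists_isGoodBranch h
    obtain ⟨A', hcut⟩ := hbranch.exists_isCutting
    exact ⟨(A', σ), trivial, rfl, t, c, hcut, hv⟩
  · rintro ⟨A, v, σ⟩ ⟨B, v', σ'⟩ ⟨A', σ''⟩ ⟨rfl, t, c, h, rfl⟩ ⟨rfl, t', c', h', rfl⟩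
    obtain ⟨rfl, rfl⟩ := h.eq_of_right h'
    rfl

end Branches

section CycleMinima

variable {α β : Type*} [LinearOrder β]

/-- `m` is the point with the smallest label on its cycle under `g`. -/
def IsCycleMin (g : α → α) (σ : α → β) (m : α) : Prop :=
  m ∈ periodicPts g ∧ ∀ i, σ m ≤ σ (g^[i] m)

/-- The periodic points with the smallest label on their cycle and their predecessors. -/
def specialVertices (g : α → α) (σ : α → β) : Set α :=
  {y | y ∈ periodicPts g ∧ (IsCycleMin g σ y ∨ IsCycleMin g σ (g y))}

lemma IsFoata.isCycleMin_lastRecord {σ : α → β} {g : α → α} {t i : ℕ} {c : ℕ → α}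
    (h : IsFoata σ g (periodicPts g) t c) (hi : i ≤ t) :
    IsCycleMin g σ (c (lastRecord (σ ∘ c) i)) := by
  have hle := (lastRecord_le (σ ∘ c) i).trans hi
  refine ⟨h.bijOn.mapsTo hle, fun m => ?_⟩
  have := h.apply_lastRecord_le_iterate hle m
  rwa [(isLowerRecord_lastRecord (σ ∘ c) i).lastRecord_eq] at this

lemma IsFoata.recordVertices_subset {σ : α → β} {g : α → α} {t : ℕ} {c : ℕ → α}
    (h : IsFoata σ g (periodicPts g) t c) : recordVertices (σ ∘ c) t c ⊆ specialVertices g σ := by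
  rintro _ ⟨i, ⟨hi, hrec | rfl⟩, rfl⟩
  · exact ⟨h.bijOn.mapsTo hi, Or.inl (hrec.lastRecord_eq ▸ h.isCycleMin_lastRecord hi)⟩
  · refine ⟨h.bijOn.mapsTo hi, Or.inr ?_⟩
    rw [h.map_eq i le_rfl, recordCycle_of_mem ⟨le_rfl, fun hlt => absurd hlt (lt_irrefl i)⟩]
    exact h.isCycleMin_lastRecord le_rfl

end CycleMinima

section Gluing

variable {n k : ℕ} [NeZero k] {A A' : Automaton n} {w : Word k} {σ : Equiv.Perm (Fin n)}
  {t : ℕ} {c : ℕ → Fin n}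

/-- The labelled automata for which special vertices return to each other only at congruence `0`. -/
def cycleGood (n : ℕ) {k : ℕ} (w : Word k) : Set (Automaton n × Equiv.Perm (Fin n)) :=
  {x | ReturnsAtZero x.1 w (specialVertices (inducedMap x.1 w) x.2)}

lemma injOn_explode_iterate_of_branch (hmap : ∀ i, inducedMap A w (c i) = c (i + 1))
    (hper : ∀ i ≤ t, c i ∈ periodicPts (inducedMap A' w)) (hinj : Set.InjOn c (Set.Iic t))
    (hiter : ∀ i ≤ t, ∀ b < k, (explode A w)^[b] (c i, 0) = (explode A' w)^[b] (c i, 0)) :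
    Set.InjOn (fun i => (explode A w)^[i] (c 0, 0)) (Set.Iio (k * (t + 1))) := by
  have hk := NeZero.pos k
  have hnode (i) (hi : i ∈ Set.Iio (k * (t + 1))) : i / k ≤ t ∧
      (explode A w)^[i] (c 0, 0) = (explode A' w)^[i % k] (c (i / k), 0) := by
    have hdiv : i / k ≤ t := Nat.lt_succ_iff.1 (Nat.div_lt_of_lt_mul hi)
    refine ⟨hdiv, ?_⟩
    rw [← hiter _ hdiv _ (Nat.mod_lt i hk)]
    nth_rewrite 1 [← Nat.mod_add_div i k]
    rw [iterate_add_apply, explode_iterate_mul, iterate_apply_of_forall_apply_eq_succ hmap,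
      zero_add]
  have hper' (i) (hi : i ≤ t) : (c i, (0 : ZMod k)) ∈ periodicPts (explode A' w) :=
    (mem_periodicPts_explode_iff A' w _).2 (hper i hi)
  intro i hi j hj hij
  dsimp only at hij
  have hmod : i % k = j % k := ((explode_iterate_eq_iff A w _ _ _ _).1 hij).2
  obtain ⟨hdi, hi_eq⟩ := hnode i hi
  obtain ⟨hdj, hj_eq⟩ := hnode j hj
  rw [hi_eq, hj_eq, hmod] at hij
  have hbij := bijOn_periodicPts (explode A' w)
  have hnodes := hbij.injOn.iterate hbij.mapsTo (j % k) (hper' _ hdi) (hper' _ hdj) hij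
  have hdiv : i / k = j / k := hinj hdi hdj (congrArg Prod.fst hnodes)
  rw [← Nat.mod_add_div i k, ← Nat.mod_add_div j k, hmod, hdiv]

lemma exists_isGoodBranch_of_isFoata
    (hF : IsFoata σ (inducedMap A' w) (periodicPts (inducedMap A' w)) t c)
    (hret : ReturnsAtZero A' w (recordVertices (σ ∘ c) t c)) :
    ∃ A, IsGoodBranch A w σ t c ∧ IsCutting w σ t c A A' := by
  set s := σ ∘ c
  have hper (i) (hi : i ≤ t) : c i ∈ periodicPts (inducedMap A' w) := hF.bijOn.mapsTo hi
  have hinj : Set.InjOn (fun i => walk A' w (c i) 0 (k - 1)) (Set.Iic t) := by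
    intro i hi j hj hij
    refine hF.bijOn.injOn hi hj
      ((bijOn_periodicPts (inducedMap A' w)).injOn (hper i hi) (hper j hj) ?_)
    rw [inducedMap_eq, inducedMap_eq]
    exact congrArg (A' (w 0)) hij
  obtain ⟨A, hred, hagree, hiter, hmap⟩ := exists_isRedirection (E := blockEnds s t)
    (next := fun i => c (i + 1)) hret hinj
    (fun i hi => ⟨_, apply_lastRecord_mem_recordVertices hi, hF.exists_iterate_lastRecord_eq hi⟩)
    (fun i hi => ⟨hi.1, hF.map_eq i hi.1 ▸ apply_recordCycle_mem_recordVertices hi,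
      apply_succ_mem_recordVertices hF.apply_of_ge hi⟩)
    (fun i hi hiE => by rw [hF.map_eq i hi, recordCycle_of_notMem hiE])
  have hmap' (i) : inducedMap A w (c i) = c (i + 1) := by
    rcases le_total i t with hi | hi
    · exact hmap i hi
    · rw [hF.apply_of_ge i hi, hmap t le_rfl, hF.apply_of_ge _ (Nat.le_succ t),
        hF.apply_of_ge (i + 1) (by lia)]
  refine ⟨A, ⟨hmap', hF.apply_of_ge,
    injOn_explode_iterate_of_branch hmap' hper hF.bijOn.injOn hiter, fun o => ?_,
    hret.of_agreeOutside hagree⟩, hmap', hF, hred.symm⟩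
  obtain ⟨j, _, ⟨i, ⟨_, -⟩, rfl⟩, hj⟩ := hret.exists_iterate_eq hagree (fun o => by
    obtain ⟨j, u, hu, hj⟩ := exists_explode_iterate_mem_periodicPts A' w o
    obtain ⟨i, hi, rfl⟩ := hF.bijOn.surjOn hu
    obtain ⟨m, hm⟩ := hF.exists_iterate_lastRecord_eq hi
    obtain ⟨l, hl⟩ := exists_iterate_iterate_eq_of_mem_periodicPts
      (hper _ ((lastRecord_le s i).trans hi)) m
    refine ⟨k * l + j, ?_⟩
    rw [iterate_add_apply, hj, explode_iterate_mul, ← hm, hl]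
    exact apply_lastRecord_mem_recordVertices hi) o
  refine ⟨k * t + j, ?_⟩
  rw [iterate_add_apply, hj, explode_iterate_mul, iterate_apply_of_forall_apply_eq_succ hmap',
    hF.apply_of_ge _ (by lia)]

lemma ncard_cycleGood_le [NeZero n] (w : Word k) :
    (cycleGood n w).ncard ≤ (goodMarkedTrees n w).ncard := by
  refine ncard_le_ncard_of_forall_exists
    (fun x y => y.2.2 = x.2 ∧ ∃ t c, IsCutting w x.2 t c y.1 x.1 ∧ c 0 = y.2.1) ?_ ?_
  · rintro ⟨A', σ⟩ h
    obtain ⟨m, hm⟩ := exists_iterate_mem_periodicPts (inducedMap A' w) 0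
    obtain ⟨t, c, hF⟩ := exists_isFoata σ.injective (Set.toFinite _) ⟨_, hm⟩
      (bijOn_periodicPts (inducedMap A' w))
    obtain ⟨A, hbranch, hcut⟩ :=
      exists_isGoodBranch_of_isFoata hF (ReturnsAtZero.mono h hF.recordVertices_subset)
    exact ⟨(A, c 0, σ), hbranch.mem_goodMarkedTrees, rfl, t, c, hcut, rfl⟩
  · rintro ⟨A', σ⟩ ⟨B', σ'⟩ ⟨A, v, τ⟩ ⟨hσ, t, c, h, hc⟩ ⟨hσ', t', c', h', hc'⟩
    obtain rfl : τ = σ := hσ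
    obtain rfl : τ = σ' := hσ'
    obtain rfl : A' = B' := h.eq_of_left h' (hc.trans hc'.symm)
    rfl

end Gluing

/-! ### Uniform probability -/

section Prob

variable {α β : Type*}

/-- The probability that a uniformly random element of a finite type lies in `S`. -/
noncomputable def prob (S : Set α) : ℝ := S.ncard / Nat.card α

lemma prob_nonneg (S : Set α) : 0 ≤ prob S := by
  unfold prob
  positivity

lemma prob_empty : prob (∅ : Set α) = 0 := by
  rw [prob, Set.ncard_empty, Nat.cast_zero, zero_div]

lemma prob_union_le (S T : Set α) : prob (S ∪ T) ≤ prob S + prob T := by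
  rw [prob, prob, prob, ← add_div]
  exact div_le_div_of_nonneg_right (mod_cast Set.ncard_union_le S T) (Nat.cast_nonneg _)

lemma prob_iUnion_le {ι : Type*} [Fintype ι] (S : ι → Set α) :
    prob (⋃ i, S i) ≤ ∑ i, prob (S i) := by
  simp only [prob, ← Finset.sum_div]
  exact div_le_div_of_nonneg_right (mod_cast Set.ncard_iUnion_le_of_fintype S) (Nat.cast_nonneg _)

lemma prob_preimage (e : α ≃ β) (S : Set β) : prob (e ⁻¹' S) = prob S := by
  rw [prob, prob, Nat.card_congr e, Set.ncard_preimage_of_injective_subset_range e.injective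
    (e.surjective.range_eq ▸ S.subset_univ)]

variable [Finite α]

lemma prob_univ [Nonempty α] : prob (Set.univ : Set α) = 1 := by
  rw [prob, Set.ncard_univ, div_self (Nat.cast_ne_zero.2 Nat.card_pos.ne')]

lemma prob_mono {S T : Set α} (h : S ⊆ T) : prob S ≤ prob T :=
  div_le_div_of_nonneg_right (Nat.cast_le.2 (Set.ncard_le_ncard h)) (Nat.cast_nonneg _)

lemma prob_le_of_ncard_mul_le [Nonempty α] {S : Set α} {c : ℕ} (hc : 0 < c)
    (h : S.ncard * c ≤ Nat.card α) : prob S ≤ 1 / c := by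
  rw [prob, div_le_div_iff₀ (mod_cast Nat.card_pos) (mod_cast hc), one_mul]
  exact_mod_cast h

lemma prob_prod_le [Finite β] {S : Set (α × β)} {H : Set α} {c : ℝ}
    (hc : ∀ a ∈ H, prob {b | (a, b) ∈ S} ≤ c) (hS : ∀ x ∈ S, x.1 ∈ H) :
    prob S ≤ prob H * c := by
  classical
  have := Fintype.ofFinite α
  have hfibre : S = ⋃ a ∈ H.toFinset, Prod.mk a '' {b | (a, b) ∈ S} := by
    ext ⟨a, b⟩
    simpa using hS (a, b)
  have hcard : S.ncard ≤ ∑ a ∈ H.toFinset, {b | (a, b) ∈ S}.ncard := by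
    conv_lhs => rw [hfibre]
    exact (Finset.set_ncard_biUnion_le _ _).trans_eq
      (Finset.sum_congr rfl fun a _ => Set.ncard_image_of_injective _ (Prod.mk_right_injective a))
  have hsum : (S.ncard : ℝ) / Nat.card β ≤ H.ncard * c := by
    calc (S.ncard : ℝ) / Nat.card β
        ≤ (∑ a ∈ H.toFinset, ({b | (a, b) ∈ S}.ncard : ℝ)) / Nat.card β := by
          gcongr
          exact_mod_cast hcard
      _ = ∑ a ∈ H.toFinset, prob {b | (a, b) ∈ S} := Finset.sum_div ..
      _ ≤ ∑ _ ∈ H.toFinset, c := Finset.sum_le_sum fun a ha => hc a (Set.mem_toFinset.1 ha)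
      _ = H.ncard * c := by rw [Finset.sum_const, nsmul_eq_mul, Set.ncard_eq_toFinset_card']
  calc prob S = (S.ncard : ℝ) / Nat.card β / Nat.card α := by
        rw [prob, Nat.card_prod, Nat.cast_mul, div_div, mul_comm]
    _ ≤ H.ncard * c / Nat.card α := by gcongr
    _ = prob H * c := by rw [prob]; ring

end Prob

/-! ### Adaptive exploration of a random function -/

lemma exp_div_le_div_sub {a b : ℝ} (hb : 0 < b) (hab : a < b) :
    Real.exp (a / b) ≤ b / (b - a) := by
  have hba : 0 < b - a := sub_pos.2 hab
  have hinv : 1 - a / b = (b / (b - a))⁻¹ := by field_simp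
  rw [← inv_inv (b / (b - a)), ← hinv, ← inv_inv (Real.exp _), ← Real.exp_neg]
  exact inv_anti₀ (hinv ▸ inv_pos.2 (div_pos hb hba)) (Real.one_sub_le_exp_neg _)

section Exploration

variable {α β γ : Type*}

/-- The value `F f` depends only on the answers `f (q f s)` to the queries made at the times
`s < t`: this is measurability with respect to the history of the exploration of `f`. -/
def IsDeterminedBefore (q : (α → β) → ℕ → α) (t : ℕ) (F : (α → β) → γ) : Prop :=
  ∀ f g, (∀ s < t, f (q f s) = g (q f s)) → F g = F f

/-- A strategy for exploring a function is adaptive if each query depends only on the answers to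
the previous ones. -/
def IsAdaptive (q : (α → β) → ℕ → α) : Prop :=
  ∀ t, IsDeterminedBefore q t (q · t)

/-- The query at time `t` was not made before, so that its answer is independent of the history. -/
def IsFresh (q : (α → β) → ℕ → α) (f : α → β) (t : ℕ) : Prop :=
  ∀ s < t, q f s ≠ q f t

/-- The query at time `τ` is fresh and its answer is `z`. -/
def IsHit (q : (α → β) → ℕ → α) (f : α → β) (τ : ℕ) (z : β) : Prop :=
  IsFresh q f τ ∧ f (q f τ) = z

variable {q : (α → β) → ℕ → α} {f : α → β} {s t : ℕ}

lemma IsDeterminedBefore.mono {F : (α → β) → γ} (h : IsDeterminedBefore q s F) (hst : s ≤ t) :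
    IsDeterminedBefore q t F :=
  fun f g hfg => h f g fun _ hr => hfg _ (hr.trans_le hst)

lemma IsDeterminedBefore.and {P R : (α → β) → Prop} (hP : IsDeterminedBefore q t P)
    (hR : IsDeterminedBefore q t R) : IsDeterminedBefore q t fun f => P f ∧ R f :=
  fun f g hfg => congrArg₂ And (hP f g hfg) (hR f g hfg)

lemma isDeterminedBefore_forall {ι : Type*} {S : Finset ι} {P : ι → (α → β) → Prop}
    (h : ∀ i ∈ S, IsDeterminedBefore q t (P i)) :
    IsDeterminedBefore q t fun f => ∀ i ∈ S, P i f :=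
  fun f g hfg => propext <| forall₂_congr fun i hi => iff_of_eq (h i hi f g hfg)

lemma IsAdaptive.isDeterminedBefore_answer (h : IsAdaptive q) (hst : s < t) :
    IsDeterminedBefore q t fun f => f (q f s) := fun f g hfg => by
  have hq : q g s = q f s := (h s).mono hst.le f g hfg
  simp only [hq, hfg s hst]

lemma IsAdaptive.isDeterminedBefore_isFresh (h : IsAdaptive q) (hst : s ≤ t) :
    IsDeterminedBefore q t (IsFresh q · s) := fun f g hfg => by
  have hq (r) (hr : r ≤ s) : q g r = q f r := (h r).mono (hr.trans hst) f g hfg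
  exact propext <| forall₂_congr fun r hr => by rw [hq r hr.le, hq s le_rfl]

lemma IsAdaptive.isDeterminedBefore_isHit (h : IsAdaptive q) {z : (α → β) → β}
    (hz : IsDeterminedBefore q s z) (hst : s < t) :
    IsDeterminedBefore q t fun f => IsHit q f s (z f) :=
  (h.isDeterminedBefore_isFresh hst.le).and fun f g hfg => by
    have hanswer : g (q g s) = f (q f s) := h.isDeterminedBefore_answer hst f g hfg
    simp only [hanswer, hz.mono hst.le f g hfg]

lemma exists_isFresh_of_query (P : α → Prop) (h : P (q f t)) :
    ∃ τ ≤ t, P (q f τ) ∧ IsFresh q f τ := by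
  classical
  have hex : ∃ t, P (q f t) := ⟨t, h⟩
  exact ⟨Nat.find hex, Nat.find_min' hex h, Nat.find_spec hex,
    fun s hs heq => Nat.find_min hex hs (heq ▸ Nat.find_spec hex)⟩

open scoped Classical in
/-- The number of fresh queries between the times `t₀` and `t`. -/
noncomputable def freshCount (q : (α → β) → ℕ → α) (f : α → β) (t₀ t : ℕ) : ℕ :=
  ((Finset.Ico t₀ t).filter (IsFresh q f)).card

open scoped Classical in
lemma freshCount_succ {t₀ : ℕ} (ht : t₀ ≤ t) :
    freshCount q f t₀ (t + 1) = freshCount q f t₀ t + if IsFresh q f t then 1 else 0 := by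
  rw [freshCount, freshCount, ← Finset.insert_Ico_right_eq_Ico_add_one ht, Finset.filter_insert]
  split_ifs
  · rw [Finset.card_insert_of_notMem (by simp)]
  · rfl

lemma IsAdaptive.isDeterminedBefore_freshCount (h : IsAdaptive q) (t₀ : ℕ) :
    IsDeterminedBefore q t (freshCount q · t₀ t) := by
  classical
  refine fun f g hfg => congrArg Finset.card (Finset.filter_congr fun s hs => ?_)
  exact iff_of_eq (h.isDeterminedBefore_isFresh (Finset.mem_Ico.1 hs).2.le f g hfg)

section Update

variable [DecidableEq α]

lemma IsDeterminedBefore.apply_update {F : (α → β) → γ} (h : IsDeterminedBefore q t F)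
    (hf : IsFresh q f t) (z : β) : F (update f (q f t) z) = F f :=
  h f _ fun s hs => (update_of_ne (hf s hs) z f).symm

open scoped Classical in
lemma IsAdaptive.sum_update_pow_freshCount_le [Fintype β] (h : IsAdaptive q)
    {D : ℕ → (α → β) → Prop} {a t₀ : ℕ} (ha : a < Fintype.card β)
    (ht : t₀ ≤ t) (hf : IsFresh q f t)
    (hstep : (Finset.univ.filter fun z => D (t + 1) (update f (q f t) z)).card + a ≤
      Fintype.card β) :
    ∑ z, (if D (t + 1) (update f (q f t) z) then (Fintype.card β / (Fintype.card β - a) : ℝ) ^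
        freshCount q (update f (q f t) z) t₀ (t + 1) else 0) ≤
      Fintype.card β * (Fintype.card β / (Fintype.card β - a) : ℝ) ^ freshCount q f t₀ t := by
  have hba : (0 : ℝ) < Fintype.card β - a := sub_pos.2 (mod_cast ha)
  have hcount (z) : freshCount q (update f (q f t) z) t₀ (t + 1) = freshCount q f t₀ t + 1 := by
    rw [freshCount_succ ht, (h.isDeterminedBefore_freshCount t₀).apply_update hf, if_pos
      (((h.isDeterminedBefore_isFresh le_rfl).apply_update hf z).mpr hf)]
  have hcard : ((Finset.univ.filter fun z => D (t + 1) (update f (q f t) z)).card : ℝ) ≤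
      Fintype.card β - a := by
    rw [le_sub_iff_add_le]
    exact_mod_cast hstep
  simp only [hcount]
  rw [← Finset.sum_filter, Finset.sum_const, nsmul_eq_mul, pow_succ]
  refine (mul_le_mul_of_nonneg_right hcard (by positivity)).trans_eq ?_
  field_simp

variable [Fintype α] [Fintype β]

lemma IsAdaptive.sum_sum_update (h : IsAdaptive q) {P : (α → β) → Prop} [DecidablePred P]
    (hP : IsDeterminedBefore q t P) (hfresh : ∀ f, P f → IsFresh q f t) {M : Type*}
    [AddCommMonoid M] (G : (α → β) → M) :
    ∑ f with P f, ∑ z, G (update f (q f t) z) = Fintype.card β • ∑ f with P f, G f := by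
  set Q : Finset (α → β) := Finset.univ.filter P
  have hfresh' (f) (hf : f ∈ Q) : IsFresh q f t := hfresh f (Finset.mem_filter.1 hf).2
  let swap : (α → β) × β → (α → β) × β := fun x => (update x.1 (q x.1 t) x.2, x.1 (q x.1 t))
  have hmaps (x) (hx : x ∈ Q ×ˢ (Finset.univ : Finset β)) : swap x ∈ Q ×ˢ Finset.univ := by
    have hx := (Finset.mem_product.1 hx).1
    refine Finset.mk_mem_product (Finset.mem_filter.2 ⟨Finset.mem_univ _, ?_⟩) (Finset.mem_univ _)
    exact (hP.apply_update (hfresh' _ hx) x.2).mpr (Finset.mem_filter.1 hx).2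
  have hswap (x) (hx : x ∈ Q ×ˢ (Finset.univ : Finset β)) : swap (swap x) = x := by
    have hq := (h t).apply_update (hfresh' _ (Finset.mem_product.1 hx).1) x.2
    simp only [swap, hq, update_idem, update_eq_self, update_self]
  calc ∑ f ∈ Q, ∑ z, G (update f (q f t) z)
      = ∑ x ∈ Q ×ˢ (Finset.univ : Finset β), G (swap x).1 := (Finset.sum_product' ..).symm
    _ = ∑ x ∈ Q ×ˢ (Finset.univ : Finset β), G x.1 :=
        Finset.sum_nbij' swap swap hmaps hmaps hswap hswap fun _ _ => rfl
    _ = Fintype.card β • ∑ f ∈ Q, G f := by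
        rw [Finset.sum_product]
        simp only [Finset.sum_const, Finset.card_univ, Finset.smul_sum]

lemma IsAdaptive.sum_le_sum_of_sum_update_le (h : IsAdaptive q) {P : (α → β) → Prop}
    [DecidablePred P] (hP : IsDeterminedBefore q t P) (hfresh : ∀ f, P f → IsFresh q f t)
    {G H : (α → β) → ℝ}
    (hGH : ∀ f, P f → ∑ z, G (update f (q f t) z) ≤ Fintype.card β * H f) :
    ∑ f with P f, G f ≤ ∑ f with P f, H f := by
  rcases isEmpty_or_nonempty (α → β) with hempty | ⟨⟨f⟩⟩
  · simp only [Finset.univ_eq_empty, Finset.filter_empty, Finset.sum_empty, le_refl]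
  have : Nonempty β := ⟨f (q f t)⟩
  have hle := Finset.sum_le_sum (s := Finset.univ.filter P) fun f hf =>
    hGH f (Finset.mem_filter.1 hf).2
  rw [h.sum_sum_update hP hfresh, nsmul_eq_mul, ← Finset.mul_sum] at hle
  exact le_of_mul_le_mul_left hle (mod_cast Fintype.card_pos)

section Survival

variable {D : ℕ → (α → β) → Prop} {a t₀ : ℕ}

open scoped Classical in
lemma IsAdaptive.sum_pow_freshCount_succ_le (h : IsAdaptive q)
    (hdet : ∀ t, IsDeterminedBefore q t (D t)) (hanti : ∀ t f, D (t + 1) f → D t f)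
    (ha : a < Fintype.card β) (ht : t₀ ≤ t)
    (hstep : ∀ f, D t f → IsFresh q f t →
      (Finset.univ.filter fun z => D (t + 1) (update f (q f t) z)).card + a ≤ Fintype.card β) :
    ∑ f with D (t + 1) f, (Fintype.card β / (Fintype.card β - a) : ℝ) ^ freshCount q f t₀ (t + 1) ≤
      ∑ f with D t f, (Fintype.card β / (Fintype.card β - a) : ℝ) ^ freshCount q f t₀ t := by
  have hba : (0 : ℝ) < Fintype.card β - a := sub_pos.2 (mod_cast ha)
  set θ : ℝ := Fintype.card β / (Fintype.card β - a)
  have hfresh := h.sum_le_sum_of_sum_update_le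
    ((hdet t).and (h.isDeterminedBefore_isFresh le_rfl)) (fun f hf => hf.2)
    (G := fun f => if D (t + 1) f then θ ^ freshCount q f t₀ (t + 1) else 0)
    (H := fun f => θ ^ freshCount q f t₀ t)
    fun f hf => h.sum_update_pow_freshCount_le ha ht hf.2 (hstep f hf.1 hf.2)
  rw [← Finset.sum_filter_add_sum_filter_not _ (IsFresh q · t),
    ← Finset.sum_filter_add_sum_filter_not (Finset.univ.filter (D t)) (IsFresh q · t)]
  simp only [Finset.filter_filter]
  refine add_le_add (le_trans (le_of_eq ?_) hfresh) ?_
  · rw [← Finset.sum_filter, Finset.filter_filter]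
    refine Finset.sum_congr (Finset.filter_congr fun f _ => ?_) fun _ _ => rfl
    exact ⟨fun hf => ⟨⟨hanti t f hf.1, hf.2⟩, hf.1⟩, fun hf => ⟨hf.2, hf.1.2⟩⟩
  · refine (Finset.sum_congr rfl fun f hf => ?_).trans_le (Finset.sum_le_sum_of_subset_of_nonneg
      (Finset.monotone_filter_right _ fun f _ hf => And.imp_left (hanti t f) hf)
      fun f _ _ => by positivity)
    rw [freshCount_succ ht, if_neg (Finset.mem_filter.1 hf).2.2, add_zero]

end Survival

end Update

section Probability

variable [Finite α] [Fintype β]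

lemma IsAdaptive.ncard_hit_mul (h : IsAdaptive q) {P : (α → β) → Prop}
    (hP : IsDeterminedBefore q t P) (hfresh : ∀ f, P f → IsFresh q f t) {z : (α → β) → β}
    (hz : IsDeterminedBefore q t z) :
    {f | P f ∧ f (q f t) = z f}.ncard * Fintype.card β = {f | P f}.ncard := by
  classical
  have := Fintype.ofFinite α
  have hone (f) (hf : f ∈ Finset.univ.filter P) :
      ∑ y, (if update f (q f t) y (q (update f (q f t) y) t) = z (update f (q f t) y)
        then 1 else 0) = 1 := by
    have hf := hfresh f (Finset.mem_filter.1 hf).2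
    simp only [(h t).apply_update hf, hz.apply_update hf, update_self, Finset.sum_ite_eq',
      Finset.mem_univ, if_true]
  have hsum := h.sum_sum_update hP hfresh fun f => if f (q f t) = z f then 1 else 0
  rw [Finset.sum_congr rfl hone, Finset.sum_const, smul_eq_mul, mul_one, ← Finset.sum_filter,
    Finset.filter_filter, Finset.sum_const, smul_eq_mul, smul_eq_mul, mul_one] at hsum
  rw [Set.ncard_eq_toFinset_card', Set.ncard_eq_toFinset_card', Set.toFinset_ofPred,
    Set.toFinset_ofPred, hsum, mul_comm]

lemma IsAdaptive.ncard_hits_mul_le (h : IsAdaptive q) (z : ℕ → (α → β) → β) (S : Finset ℕ)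
    (hz : ∀ τ ∈ S, IsDeterminedBefore q τ (z τ)) :
    {f | ∀ τ ∈ S, IsHit q f τ (z τ f)}.ncard * Fintype.card β ^ S.card ≤ Nat.card (α → β) := by
  induction S using Finset.induction_on_max with
  | empty => simp
  | insert a S ha ih =>
    have ih := ih fun τ hτ => hz τ (Finset.mem_insert_of_mem hτ)
    have hdet : IsDeterminedBefore q a fun f => (∀ τ ∈ S, IsHit q f τ (z τ f)) ∧ IsFresh q f a :=
      (isDeterminedBefore_forall fun τ hτ => h.isDeterminedBefore_isHit
        (hz τ (Finset.mem_insert_of_mem hτ)) (ha τ hτ)).and (h.isDeterminedBefore_isFresh le_rfl)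
    have hset : {f | ∀ τ ∈ insert a S, IsHit q f τ (z τ f)} =
        {f | ((∀ τ ∈ S, IsHit q f τ (z τ f)) ∧ IsFresh q f a) ∧ f (q f a) = z a f} :=
      Set.ext fun f => (Finset.forall_mem_insert ..).trans (and_comm.trans and_assoc.symm)
    rw [hset, Finset.card_insert_of_notMem fun h => (ha a h).false, pow_succ', ← mul_assoc,
      h.ncard_hit_mul hdet (fun f hf => hf.2) (hz a (Finset.mem_insert_self a S))]
    exact (Nat.mul_le_mul_right _ (Set.ncard_le_ncard fun f hf => hf.1)).trans ih

lemma IsAdaptive.prob_hits_le [Nonempty β] (h : IsAdaptive q) (z : ℕ → (α → β) → β)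
    (S : Finset ℕ) (hz : ∀ τ ∈ S, IsDeterminedBefore q τ (z τ)) :
    prob {f | ∀ τ ∈ S, IsHit q f τ (z τ f)} ≤ 1 / (Fintype.card β : ℝ) ^ S.card := by
  rw [← Nat.cast_pow]
  exact prob_le_of_ncard_mul_le (pow_pos Fintype.card_pos _) (h.ncard_hits_mul_le z S hz)

open scoped Classical in
lemma IsAdaptive.prob_survival_le [DecidableEq α] (h : IsAdaptive q)
    {D : ℕ → (α → β) → Prop} {a t₀ : ℕ} (hdet : ∀ t, IsDeterminedBefore q t (D t))
    (hanti : ∀ t f, D (t + 1) f → D t f) (ha : a < Fintype.card β)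
    (hstep : ∀ t ≥ t₀, ∀ f, D t f → IsFresh q f t →
      (Finset.univ.filter fun z => D (t + 1) (update f (q f t) z)).card + a ≤ Fintype.card β)
    {m : ℕ} (ht : t₀ ≤ t) (hm : ∀ f, D t f → m ≤ freshCount q f t₀ t) :
    prob {f | D t f} ≤ Real.exp (-(a * m / Fintype.card β)) := by
  have := Fintype.ofFinite α
  have : Nonempty β := Fintype.card_pos_iff.1 ((Nat.zero_le a).trans_lt ha)
  have hexp := exp_div_le_div_sub (a := a) (b := Fintype.card β) (mod_cast Fintype.card_pos)
    (mod_cast ha)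
  set θ : ℝ := Fintype.card β / (Fintype.card β - a)
  have hθ : 1 ≤ θ := (Real.one_le_exp (by positivity)).trans hexp
  have hsum (t) (ht : t₀ ≤ t) :
      ∑ f with D t f, θ ^ freshCount q f t₀ t ≤ Nat.card (α → β) := by
    induction t, ht using Nat.le_induction with
    | base =>
      simp only [freshCount, Finset.Ico_self, Finset.filter_empty, Finset.card_empty, pow_zero,
        Finset.sum_const, nsmul_eq_mul, mul_one, Nat.card_eq_fintype_card]
      exact_mod_cast Finset.card_le_univ _
    | succ t ht ih => exact (h.sum_pow_freshCount_succ_le hdet hanti ha ht (hstep t ht)).trans ih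
  have hcard : {f | D t f}.ncard * θ ^ m ≤ Nat.card (α → β) := by
    rw [Set.ncard_eq_toFinset_card', Set.toFinset_ofPred, ← nsmul_eq_mul, ← Finset.sum_const]
    exact (Finset.sum_le_sum fun f hf =>
      pow_le_pow_right₀ hθ (hm f (Finset.mem_filter.1 hf).2)).trans (hsum t ht)
  have hcard_pos : (0 : ℝ) < Nat.card (α → β) := mod_cast Nat.card_pos
  rw [Real.exp_neg, prob, div_le_iff₀ hcard_pos, ← div_eq_inv_mul, le_div_iff₀ (Real.exp_pos _)]
  refine le_trans (mul_le_mul_of_nonneg_left ?_ (Nat.cast_nonneg _)) hcard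
  rw [mul_comm (a : ℝ), mul_div_assoc, Real.exp_nat_mul]
  exact pow_le_pow_left₀ (Real.exp_pos _).le hexp m

end Probability

end Exploration

/-! ### Threads are short -/

section LongThreads

variable {n k : ℕ} (w : Word k) (u : Fin n) (r : ZMod k)

/-- The exploration of a random automaton along a walk: the query at time `t` is the pair (letter,
vertex) that determines the step at time `t`. -/
def walkQuery (f : Letter × Fin n → Fin n) (t : ℕ) : Letter × Fin n :=
  (w (r + t + 1), walk (curry f) w u r t)

lemma isAdaptive_walkQuery : IsAdaptive (walkQuery w u r) := by
  intro t f g hfg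
  refine congrArg (Prod.mk _) ?_
  induction t with
  | zero => rfl
  | succ t ih =>
    have hwalk := ih fun s hs => hfg s (hs.trans_le t.le_succ)
    rw [walk_succ, hwalk]
    exact (hfg t t.lt_succ_self).symm

/-- The first `t + 1` nodes of the exploded walk are distinct: the thread is longer than `t`. -/
def NoRepetition (t : ℕ) (f : Letter × Fin n → Fin n) : Prop :=
  Set.InjOn (fun i => (explode (curry f) w)^[i] (u, r)) (Set.Iic t)

variable {w u r} {f : Letter × Fin n → Fin n} {t : ℕ}

lemma NoRepetition.eq_of_walk_eq (h : NoRepetition w u r t f) {i j : ℕ} (hi : i ≤ t) (hj : j ≤ t)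
    (hmod : i ≡ j [MOD k]) (heq : walk (curry f) w u r i = walk (curry f) w u r j) : i = j :=
  h hi hj ((explode_iterate_eq_iff _ _ _ _ _ _).2 ⟨heq, hmod⟩)

lemma isDeterminedBefore_noRepetition : IsDeterminedBefore (walkQuery w u r) t
    (NoRepetition w u r t) := by
  refine fun f g hfg => propext (Set.EqOn.injOn_iff fun i hi => ?_)
  have hquery := ((isAdaptive_walkQuery w u r) i).mono hi f g hfg
  simp only [explode_iterate]
  exact congrArg₂ Prod.mk (congrArg Prod.snd hquery) rfl

open scoped Classical in
lemma card_noRepetition_update_add_le [NeZero k] {a : ℕ} (ht : k * a ≤ t)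
    (hf : NoRepetition w u r t f) (hfresh : IsFresh (walkQuery w u r) f t) :
    (Finset.univ.filter fun z =>
      NoRepetition w u r (t + 1) (update f (walkQuery w u r f t) z)).card + a ≤
      Fintype.card (Fin n) := by
  have hk := NeZero.pos k
  have hmod (m : ℕ) : (t + 1) % k + k * m ≡ t + 1 [MOD k] := by simp [Nat.ModEq]
  have hle (m) (hm : m ∈ Finset.range a) : (t + 1) % k + k * m ≤ t := by
    have := Nat.mul_le_mul_left k (Nat.succ_le_of_lt (Finset.mem_range.1 hm))
    have := Nat.mod_lt (t + 1) hk
    lia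
  -- Answering with one of these `a` vertices closes the thread.
  let closing : Finset (Fin n) :=
    (Finset.range a).image fun m => walk (curry f) w u r ((t + 1) % k + k * m)
  have hclosing : closing.card = a := by
    rw [Finset.card_image_of_injOn, Finset.card_range]
    intro m hm m' hm' heq
    have := hf.eq_of_walk_eq (hle m hm) (hle m' hm') ((hmod m).trans (hmod m').symm) heq
    exact Nat.eq_of_mul_eq_mul_left hk (Nat.add_left_cancel this)
  rw [← hclosing, ← Finset.card_union_of_disjoint]
  · exact Finset.card_le_univ _
  rw [Finset.disjoint_left]
  intro z hz hzmem
  obtain ⟨m, hm, rfl⟩ := Finset.mem_image.1 hzmem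
  set g := update f (walkQuery w u r f t) (walk (curry f) w u r ((t + 1) % k + k * m)) with hg
  have hquery (i) (hi : i ≤ t) : walkQuery w u r g i = walkQuery w u r f i :=
    ((isAdaptive_walkQuery w u r i).mono hi).apply_update hfresh _
  have hlast : walk (curry g) w u r (t + 1) = walk (curry f) w u r ((t + 1) % k + k * m) := by
    change g (walkQuery w u r g t) = _
    rw [hquery t le_rfl, hg, update_self]
  have heq := (Finset.mem_filter.1 hz).2.eq_of_walk_eq ((hle m hm).trans t.le_succ) le_rfl
    (hmod m) ((congrArg Prod.snd (hquery _ (hle m hm))).trans hlast.symm)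
  exact (heq.symm.trans_le (hle m hm)).not_gt t.lt_succ_self

open scoped Classical in
lemma le_mul_card_isFresh [NeZero k] (h : NoRepetition w u r t f) :
    t ≤ k * ((Finset.range t).filter (IsFresh (walkQuery w u r) f)).card := by
  have hfibre (e) : ((Finset.range t).filter (walkQuery w u r f · = e)).card ≤ k := by
    refine (Finset.card_le_card_of_injOn (t := Finset.range k) (· % k) (fun s _ => Finset.mem_coe.2
      (Finset.mem_range.2 (Nat.mod_lt s (NeZero.pos k)))) ?_).trans_eq (Finset.card_range k)
    intro s hs s' hs' hmod
    obtain ⟨hst, hs⟩ := Finset.mem_filter.1 hs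
    obtain ⟨hst', hs'⟩ := Finset.mem_filter.1 hs'
    exact h.eq_of_walk_eq (Finset.mem_range.1 hst).le (Finset.mem_range.1 hst').le hmod
      (congrArg Prod.snd (hs.trans hs'.symm))
  have himage : (Finset.range t).image (walkQuery w u r f) ⊆
      ((Finset.range t).filter (IsFresh (walkQuery w u r) f)).image (walkQuery w u r f) := by
    intro e he
    obtain ⟨s, hs, rfl⟩ := Finset.mem_image.1 he
    obtain ⟨τ, hτ, heq, hfresh⟩ :=
      exists_isFresh_of_query (· = walkQuery w u r f s) (rfl : walkQuery w u r f s = _)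
    exact Finset.mem_image.2 ⟨τ, Finset.mem_filter.2
      ⟨Finset.mem_range.2 (hτ.trans_lt (Finset.mem_range.1 hs)), hfresh⟩, heq⟩
  calc t = (Finset.range t).card := (Finset.card_range t).symm
    _ ≤ k * ((Finset.range t).image (walkQuery w u r f)).card :=
        Finset.card_le_mul_card_image _ k fun e _ => hfibre e
    _ ≤ k * ((Finset.range t).filter (IsFresh (walkQuery w u r) f)).card :=
        Nat.mul_le_mul_left k ((Finset.card_le_card himage).trans Finset.card_image_le)

lemma NoRepetition.le_freshCount [NeZero k] {t₀ : ℕ} (h : NoRepetition w u r (2 * k * t₀) f) :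
    t₀ ≤ freshCount (walkQuery w u r) f t₀ (2 * k * t₀) := by
  classical
  have hsplit : (Finset.range (2 * k * t₀)).filter (IsFresh (walkQuery w u r) f) ⊆
      Finset.range t₀ ∪ (Finset.Ico t₀ (2 * k * t₀)).filter (IsFresh (walkQuery w u r) f) := by
    intro s
    simp only [Finset.mem_filter, Finset.mem_range, Finset.mem_union, Finset.mem_Ico]
    rcases lt_or_ge s t₀ with hs | hs <;> tauto
  have hcard := (Finset.card_le_card hsplit).trans (Finset.card_union_le _ _)
  rw [Finset.card_range] at hcard
  have hmul : k * (2 * t₀) ≤ k * (t₀ + freshCount (walkQuery w u r) f t₀ (2 * k * t₀)) :=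
    calc k * (2 * t₀) = 2 * k * t₀ := by ring
      _ ≤ _ := (le_mul_card_isFresh h).trans (Nat.mul_le_mul_left k hcard)
  have := Nat.le_of_mul_le_mul_left hmul (NeZero.pos k)
  lia

variable (w u r) in
lemma prob_noRepetition_le [NeZero k] {a : ℕ} (ha : a < n) :
    prob {f | NoRepetition w u r (2 * k * (k * a)) f} ≤ Real.exp (-(a ^ 2 / n)) := by
  have hk := NeZero.pos k
  refine ((isAdaptive_walkQuery w u r).prob_survival_le (D := NoRepetition w u r) (a := a)
    (t₀ := k * a) (m := k * a) (fun t => isDeterminedBefore_noRepetition)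
    (fun t f h => h.mono (Set.Iic_subset_Iic.2 t.le_succ)) (by rwa [Fintype.card_fin])
    (fun t ht f => card_noRepetition_update_add_le ht)
    (Nat.le_mul_of_pos_left _ (Nat.mul_pos two_pos hk)) fun f hf => hf.le_freshCount).trans ?_
  rw [Fintype.card_fin, sq]
  gcongr
  exact_mod_cast Nat.le_mul_of_pos_left a hk

end LongThreads

/-! ### Labels of cycle minima -/

section Labels

open Equiv.Perm in
lemma ncard_forall_le_mul_ncard_le {α : Type*} [Finite α] [LinearOrder α]
    {Q : Set (Equiv.Perm α)} {O : Set α} {m : α} (hm : m ∈ O)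
    (hQ : ∀ σ ∈ Q, ∀ x ∈ O, σ * Equiv.swap m x ∈ Q) :
    {σ ∈ Q | ∀ x ∈ O, σ m ≤ σ x}.ncard * O.ncard ≤ Q.ncard := by
  have hswap (x) (hx : x ∈ O) (y) (hy : y ∈ O) : Equiv.swap m x y ∈ O := by
    rw [Equiv.swap_apply_def]
    split_ifs <;> assumption
  have hmin (σ : Equiv.Perm α) (hσ : ∀ x ∈ O, σ m ≤ σ x) (x) (hx : x ∈ O) (y) (hy : y ∈ O) :
      (σ * Equiv.swap m x) x ≤ (σ * Equiv.swap m x) y := by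
    rw [mul_apply, mul_apply, Equiv.swap_apply_right]
    exact hσ _ (hswap x hx y hy)
  rw [← Set.ncard_prod]
  refine Set.ncard_le_ncard_of_injOn (fun y => y.1 * Equiv.swap m y.2)
    (fun y hy => hQ _ hy.1.1 _ hy.2) ?_
  rintro ⟨σ, x⟩ ⟨⟨-, hσ⟩, hx⟩ ⟨τ, y⟩ ⟨⟨-, hτ⟩, hy⟩ heq
  dsimp only at heq
  have hxy : x = y := (σ * Equiv.swap m x).injective <|
    le_antisymm (hmin σ hσ x hx y hy) (by rw [heq]; exact hmin τ hτ y hy x hx)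
  subst hxy
  rw [mul_right_cancel heq]

variable {α : Type*} {g : α → α}

lemma ncard_range_iterate {x : α} (hx : x ∈ periodicPts g) :
    (Set.range fun i => g^[i] x).ncard = minimalPeriod g x := by
  have hrange : (Set.range fun i => g^[i] x) =
      (fun i => g^[i] x) '' Finset.range (minimalPeriod g x) := by
    refine Set.Subset.antisymm ?_ (Set.image_subset_range _ _)
    rintro _ ⟨i, rfl⟩
    exact ⟨i % minimalPeriod g x, Finset.mem_coe.2 (Finset.mem_range.2
      (Nat.mod_lt i (minimalPeriod_pos_of_mem_periodicPts hx))), iterate_mod_minimalPeriod_eq⟩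
  rw [hrange, Set.InjOn.ncard_image, Set.ncard_coe_finset, Finset.card_range]
  intro i hi j hj h
  exact (iterate_eq_iterate_iff_of_lt_minimalPeriod (Finset.mem_range.1 hi)
    (Finset.mem_range.1 hj)).1 h

lemma IsCycleMin.eq_of_iterate_eq_iterate {β : Type*} [LinearOrder β] {σ : α → β}
    (hσ : Injective σ) {m m' : α} (hm : IsCycleMin g σ m) (hm' : IsCycleMin g σ m') {i j : ℕ}
    (h : g^[i] m = g^[j] m') : m = m' := by
  obtain ⟨l, hl⟩ := exists_iterate_iterate_eq_of_mem_periodicPts hm.1 i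
  obtain ⟨l', hl'⟩ := exists_iterate_iterate_eq_of_mem_periodicPts hm'.1 j
  rw [h, ← iterate_add_apply] at hl
  rw [← h, ← iterate_add_apply] at hl'
  exact hσ (le_antisymm (hl' ▸ hm.2 (l' + i)) (hl ▸ hm'.2 (l + j)))

variable [Finite α] [LinearOrder α]

lemma ncard_isCycleMin_mul_le {m : α} (hm : m ∈ periodicPts g) :
    {σ : Equiv.Perm α | IsCycleMin g σ m}.ncard * minimalPeriod g m ≤
      Nat.card (Equiv.Perm α) := by
  rw [← ncard_range_iterate hm, ← Set.ncard_univ]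
  refine le_trans (Nat.mul_le_mul_right _ (Set.ncard_le_ncard ?_)) <|
    ncard_forall_le_mul_ncard_le (Q := Set.univ) (m := m) ⟨0, rfl⟩ fun _ _ _ _ => Set.mem_univ _
  exact fun σ hσ => ⟨Set.mem_univ σ, Set.forall_mem_range.2 hσ.2⟩

lemma ncard_isCycleMin_isCycleMin_mul_le {m m' : α} (hm : m ∈ periodicPts g)
    (hm' : m' ∈ periodicPts g) (hne : m ≠ m') :
    {σ : Equiv.Perm α | IsCycleMin g σ m ∧ IsCycleMin g σ m'}.ncard *
      (minimalPeriod g m * minimalPeriod g m') ≤ Nat.card (Equiv.Perm α) := by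
  by_cases horbit : ∃ i j, g^[i] m = g^[j] m'
  · obtain ⟨i, j, hij⟩ := horbit
    have hempty : {σ : Equiv.Perm α | IsCycleMin g σ m ∧ IsCycleMin g σ m'} = ∅ :=
      Set.eq_empty_of_forall_notMem fun σ hσ =>
        hne (hσ.1.eq_of_iterate_eq_iterate σ.injective hσ.2 hij)
    rw [hempty, Set.ncard_empty, zero_mul]
    exact Nat.zero_le _
  push Not at horbit
  refine le_trans ?_ (ncard_isCycleMin_mul_le hm)
  rw [mul_comm (minimalPeriod g m), ← mul_assoc, ← ncard_range_iterate hm']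
  refine Nat.mul_le_mul_right _ (le_trans (Nat.mul_le_mul_right _ (Set.ncard_le_ncard ?_)) <|
    ncard_forall_le_mul_ncard_le (Q := {σ : Equiv.Perm α | IsCycleMin g σ m}) (m := m')
      ⟨0, rfl⟩ ?_)
  · exact fun σ hσ => ⟨hσ.1, Set.forall_mem_range.2 hσ.2.2⟩
  · rintro σ hσ _ ⟨j, rfl⟩
    have hfix (i : ℕ) : (σ * Equiv.swap m' (g^[j] m')) (g^[i] m) = σ (g^[i] m) :=
      congrArg σ (Equiv.swap_apply_of_ne_of_ne (horbit i 0) (horbit i j))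
    exact ⟨hm, fun i => (hfix 0).trans_le ((hσ.2 i).trans_eq (hfix i).symm)⟩

lemma prob_isCycleMin_le {m : α} (hm : m ∈ periodicPts g) :
    prob {σ : Equiv.Perm α | IsCycleMin g σ m} ≤ 1 / minimalPeriod g m :=
  prob_le_of_ncard_mul_le (minimalPeriod_pos_of_mem_periodicPts hm) (ncard_isCycleMin_mul_le hm)

lemma prob_isCycleMin_isCycleMin_le {m m' : α} (hm : m ∈ periodicPts g)
    (hm' : m' ∈ periodicPts g) (hne : m ≠ m') :
    prob {σ : Equiv.Perm α | IsCycleMin g σ m ∧ IsCycleMin g σ m'} ≤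
      1 / minimalPeriod g m * (1 / minimalPeriod g m') := by
  rw [one_div_mul_one_div, ← Nat.cast_mul]
  exact prob_le_of_ncard_mul_le (Nat.mul_pos (minimalPeriod_pos_of_mem_periodicPts hm)
    (minimalPeriod_pos_of_mem_periodicPts hm')) (ncard_isCycleMin_isCycleMin_mul_le hm hm' hne)

lemma one_div_le_of_lt_mul {k p τ : ℕ} (h : τ < k * p) : (1 : ℝ) / p ≤ k / (τ + 1) := by
  have hp : 0 < p := Nat.pos_of_ne_zero fun h0 => by simp [h0] at h
  rw [div_le_div_iff₀ (mod_cast hp) (by positivity), one_mul]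
  exact_mod_cast h

end Labels

/-! ### Coincidences in an exploration -/

section Coincidences

variable {α β γ : Type*} {q q₁ : (α → β) → ℕ → α} {q₂ : γ → (α → β) → ℕ → α} {f : α → β}
  {M t : ℕ} {F : (α → β) → γ}

/-- The exploration that makes `M` queries of `q₁` and then continues with `q₂ (F f)`, where the
parameter `F f` is meant to depend on the answers to the first `M` queries only. -/
def exploreThen (q₁ : (α → β) → ℕ → α) (M : ℕ) (F : (α → β) → γ) (q₂ : γ → (α → β) → ℕ → α)
    (f : α → β) (t : ℕ) : α :=
  if t < M then q₁ f t else q₂ (F f) f (t - M)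

lemma exploreThen_of_lt (ht : t < M) : exploreThen q₁ M F q₂ f t = q₁ f t := if_pos ht

lemma exploreThen_add : exploreThen q₁ M F q₂ f (M + t) = q₂ (F f) f t := by
  rw [exploreThen, if_neg (Nat.not_lt.2 (Nat.le_add_right M t)), Nat.add_sub_cancel_left]

lemma IsDeterminedBefore.exploreThen_left {δ : Type*} {G : (α → β) → δ}
    (h : IsDeterminedBefore q₁ t G) (ht : t ≤ M) :
    IsDeterminedBefore (exploreThen q₁ M F q₂) t G := fun f g hfg => h f g fun s hs => by
  simpa only [exploreThen_of_lt (hs.trans_le ht)] using hfg s hs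

lemma IsDeterminedBefore.exploreThen_right {δ : Type*} {G : (α → β) → δ} {c : γ}
    (h : IsDeterminedBefore (q₂ c) t G) :
    IsDeterminedBefore (exploreThen q₁ M (fun _ => c) q₂) (M + t) G :=
  fun f g hfg => h f g fun s hs => by
    simpa only [exploreThen_add] using hfg (M + s) (Nat.add_lt_add_left hs M)

lemma IsAdaptive.exploreThen (h₁ : IsAdaptive q₁) (hF : IsDeterminedBefore q₁ M F)
    (h₂ : ∀ c, IsAdaptive (q₂ c)) : IsAdaptive (exploreThen q₁ M F q₂) := by
  intro t f g hfg
  dsimp only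
  rcases lt_or_ge t M with ht | ht
  · rw [exploreThen_of_lt ht, exploreThen_of_lt ht]
    exact (h₁ t).exploreThen_left ht.le f g hfg
  · obtain ⟨t, rfl⟩ := Nat.exists_eq_add_of_le ht
    have hFg : F g = F f := (hF.exploreThen_left le_rfl).mono ht f g hfg
    rw [exploreThen_add, exploreThen_add, hFg]
    refine h₂ (F f) t f g fun s hs => ?_
    simpa only [exploreThen_add] using hfg (M + s) (Nat.add_lt_add_left hs M)

lemma exists_isFresh_ne_of_ne {s t T : ℕ} {z : β} (hs : s < T) (ht : t < T)
    (hsz : f (q f s) = z) (htz : f (q f t) = z) (hne : q f s ≠ q f t) (e : α) :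
    ∃ τ < T, q f τ ≠ e ∧ IsHit q f τ z := by
  have hfirst {s} (hs : s < T) (h : f (q f s) = z ∧ q f s ≠ e) :
      ∃ τ < T, q f τ ≠ e ∧ IsHit q f τ z := by
    obtain ⟨τ, hτ, ⟨hz, hne⟩, hfresh⟩ := exists_isFresh_of_query (fun x => f x = z ∧ x ≠ e) h
    exact ⟨τ, hτ.trans_lt hs, hne, hfresh, hz⟩
  by_cases he : q f s = e
  · exact hfirst ht ⟨htz, he ▸ hne.symm⟩
  · exact hfirst hs ⟨hsz, he⟩

lemma exists_two_hits {c : ℕ → β} {L N i T : ℕ} (hc : ∀ t < M, f (q f t) = c (t + 1)) (hMT : M ≤ T)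
    (hL : 1 ≤ L) (hLM : L ≤ M) (hclose : c L = c 0) (hNM : N ≤ M) (hi : i < N) (ht : t < T)
    (hne : q f t ≠ q f i) (hz : f (q f t) = f (q f i)) :
    ∃ τ₁ < L, ∃ i₀ ≤ N, ∃ τ₂ < T, τ₁ ≠ τ₂ ∧ i₀ ≤ τ₂ ∧ IsHit q f τ₁ (c 0) ∧ IsHit q f τ₂ (c i₀) := by
  classical
  obtain ⟨τ₁, hτ₁, hτ₁z, hτ₁fresh⟩ := exists_isFresh_of_query (f · = c 0)
    (show f (q f (L - 1)) = c 0 by rw [hc _ (by lia), Nat.sub_add_cancel hL, hclose])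
  have hiM : i < M := hi.trans_le hNM
  have hfirst : ∃ i₀, c i₀ = c (i + 1) := ⟨i + 1, rfl⟩
  have hsecond := exists_isFresh_ne_of_ne ht (hiM.trans_le hMT)
    (hz.trans ((hc i hiM).trans (Nat.find_spec hfirst).symm))
    ((hc i hiM).trans (Nat.find_spec hfirst).symm) hne
  have hle : Nat.find hfirst ≤ i + 1 := Nat.find_min' hfirst rfl
  have hmin (j) (hj : j < Nat.find hfirst) : c j ≠ c (Nat.find hfirst) := fun h =>
    Nat.find_min hfirst hj (h.trans (Nat.find_spec hfirst))
  revert hsecond hle hmin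
  generalize Nat.find hfirst = i₀
  intro hsecond hle hmin
  rcases i₀ with _ | i₀
  · obtain ⟨τ₂, hτ₂, hne, hhit⟩ := hsecond (q f τ₁)
    exact ⟨τ₁, by lia, 0, N.zero_le, τ₂, hτ₂, fun h => hne (h ▸ rfl), τ₂.zero_le,
      ⟨hτ₁fresh, hτ₁z⟩, hhit⟩
  · obtain ⟨τ₂, hτ₂, hne, hhit⟩ := hsecond (q f i₀)
    refine ⟨τ₁, by lia, i₀ + 1, by lia, τ₂, hτ₂, ?_, ?_, ⟨hτ₁fresh, hτ₁z⟩, hhit⟩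
    · rintro rfl
      exact hmin 0 i₀.succ_pos (hτ₁z.symm.trans hhit.2)
    · by_contra! hlt
      have hτ₂i : τ₂ ≠ i₀ := fun h => hne (h ▸ rfl)
      exact hmin (τ₂ + 1) (by lia) ((hc τ₂ (by lia)).symm.trans hhit.2)

end Coincidences

/-! ### Configurations of a pair that is not good -/

section Configurations

variable {n k : ℕ} {w : Word k} {f : Letter × Fin n → Fin n} {σ : Equiv.Perm (Fin n)}
  {q q' : Fin n} {i' j M t : ℕ} {r : ZMod k}

/-- The exploration of `M` steps of the walk of `(q, 0)`, then of `M` steps of the walk of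
`(q', 0)`, and finally of the walk that starts with congruence `r` at the vertex that the walk of
`(q', 0)` occupies at time `i'`. -/
def threeWalks (w : Word k) (q q' : Fin n) (i' : ℕ) (r : ZMod k) (M : ℕ) :
    (Letter × Fin n → Fin n) → ℕ → Letter × Fin n :=
  exploreThen (exploreThen (walkQuery w q 0) M (fun _ => q') (walkQuery w · 0)) (2 * M)
    (fun f => walk (curry f) w q' 0 i') (walkQuery w · r)

lemma threeWalks_first (ht : t < M) :
    threeWalks w q q' i' r M f t = walkQuery w q 0 f t := by
  rw [threeWalks, exploreThen_of_lt (by lia), exploreThen_of_lt ht]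

lemma threeWalks_second (ht : t < M) :
    threeWalks w q q' i' r M f (M + t) = walkQuery w q' 0 f t := by
  rw [threeWalks, exploreThen_of_lt (by lia), exploreThen_add]

lemma threeWalks_third :
    threeWalks w q q' i' r M f (2 * M + t) = walkQuery w (walk (curry f) w q' 0 i') r f t :=
  exploreThen_add

lemma isDeterminedBefore_walk (w : Word k) (q : Fin n) (r : ZMod k) (i : ℕ) :
    IsDeterminedBefore (walkQuery w q r) i fun f => walk (curry f) w q r i :=
  fun f g hfg => congrArg Prod.snd (isAdaptive_walkQuery w q r i f g hfg)

lemma isAdaptive_threeWalks (hi' : i' ≤ M) : IsAdaptive (threeWalks w q q' i' r M) := by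
  refine ((isAdaptive_walkQuery w q 0).exploreThen (fun _ _ _ => rfl)
    fun c => isAdaptive_walkQuery w c 0).exploreThen ?_ fun c => isAdaptive_walkQuery w c r
  rw [two_mul]
  exact ((isDeterminedBefore_walk w q' 0 i').mono hi').exploreThen_right

lemma isDeterminedBefore_threeWalks_walk {i₀ τ : ℕ} (hi₀ : i₀ ≤ M) (hτ : i₀ ≤ τ) :
    IsDeterminedBefore (threeWalks w q q' i' r M) τ fun f => walk (curry f) w q 0 i₀ :=
  (((isDeterminedBefore_walk w q 0 i₀).exploreThen_left hi₀).exploreThen_left (by lia)).mono hτ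

/-- The part of the data of a bad pair that concerns one cycle of the induced map: two hits of the
exploration `threeWalks`, one where the walk along the cycle of `q` closes and one where the third
walk, or the cycle itself, comes back to the vertex at time `i₀`. -/
structure IsSingleConfig (w : Word k) (M : ℕ) (f : Letter × Fin n → Fin n)
    (σ : Equiv.Perm (Fin n)) (q q' : Fin n) (j : ℕ) (r : ZMod k) (i₀ τ₁ τ₂ : ℕ) : Prop where
  base_mem : q ∈ periodicPts (inducedMap (curry f) w)
  isCycleMin : IsCycleMin (inducedMap (curry f) w) σ
    (inducedMap (curry f) w (inducedMap (curry f) w q))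
  closing_lt : τ₁ < k * minimalPeriod (inducedMap (curry f) w) q
  closing_ne : τ₁ ≠ τ₂
  start_le : i₀ ≤ τ₂
  closing_isHit : IsHit (threeWalks w q q' (k * j) r M) f τ₁ q
  merging_isHit : IsHit (threeWalks w q q' (k * j) r M) f τ₂ (walk (curry f) w q 0 i₀)

/-- The data of a bad pair for which the third walk starts on another cycle, that of `q'`: the walk
along this cycle closes with a third hit. -/
structure IsDoubleConfig (w : Word k) (M : ℕ) (f : Letter × Fin n → Fin n)
    (σ : Equiv.Perm (Fin n)) (q q' : Fin n) (j : ℕ) (r : ZMod k) (i₀ τ₁ τ₂ τ₃ : ℕ) : Prop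
    extends IsSingleConfig w M f σ q q' j r i₀ τ₁ τ₂ where
  base_mem' : q' ∈ periodicPts (inducedMap (curry f) w)
  isCycleMin' : IsCycleMin (inducedMap (curry f) w) σ (inducedMap (curry f) w q')
  isCycleMin_ne : inducedMap (curry f) w (inducedMap (curry f) w q) ≠ inducedMap (curry f) w q'
  closing_lt' : τ₃ < k * minimalPeriod (inducedMap (curry f) w) q'
  closing_ne' : τ₁ ≠ M + τ₃
  merging_ne' : τ₂ ≠ M + τ₃
  closing_isHit' : IsHit (threeWalks w q q' (k * j) r M) f (M + τ₃) q'

lemma exists_divergence [NeZero k] (hw : ¬ IsSelfConjugate w) {x : Fin n} {s : ZMod k} {m : ℕ}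
    (hj : 1 ≤ j) (h : (explode (curry f) w)^[m] (x, r) = (walk (curry f) w q 0 (k * j), s))
    (hs : s ≠ 0) :
    (∃ i < k * j, ∃ t < m, walkQuery w x r f t ≠ walkQuery w q 0 f i ∧
      f (walkQuery w x r f t) = f (walkQuery w q 0 f i)) ∨
    (m < k ∧ ∃ i, i + m = k * j ∧ walk (curry f) w q 0 i = x) := by
  by_contra! hcon
  obtain ⟨hmerge, hstart⟩ := hcon
  rw [explode_iterate, Prod.mk.injEq] at h
  obtain ⟨hvert, hsum⟩ := h
  have hkj : k ≤ k * j := Nat.le_mul_of_pos_right k hj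
  have hwalk (d : ℕ) : ∀ i t, i + d = k * j → t + d = m →
      walk (curry f) w x r t = walk (curry f) w q 0 i := by
    induction d with
    | zero => rintro i t rfl rfl; exact hvert
    | succ d ih =>
      intro i t hi ht
      by_contra hne
      exact hmerge i (by lia) t (by lia) (fun heq => hne (congrArg Prod.snd heq))
        (ih (i + 1) (t + 1) (by lia) (by lia))
  by_cases hm : m < k
  · exact hstart hm (k * j - m) (by lia) (hwalk m _ 0 (by lia) (by lia)).symm
  -- All the letters read on the last `k` steps agree, so `w` is invariant under rotation by `s`.
  refine hw ⟨s, hs, fun c => ?_⟩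
  have hd : (-c).val < k := ZMod.val_lt _
  obtain ⟨i, hi⟩ := Nat.exists_eq_add_of_le (show (-c).val + 1 ≤ k * j by lia)
  obtain ⟨t, ht⟩ := Nat.exists_eq_add_of_le (show (-c).val + 1 ≤ m by lia)
  have hquery : walkQuery w x r f t = walkQuery w q 0 f i := by
    by_contra hne
    exact hmerge i (by lia) t (by lia) hne
      (hwalk (-c).val (i + 1) (t + 1) (by lia) (by lia))
  have hi' : (0 : ZMod k) = -c + 1 + i := by
    simpa only [Nat.cast_mul, CharP.cast_eq_zero, zero_mul, Nat.cast_add, ZMod.natCast_zmod_val,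
      Nat.cast_one] using congrArg (Nat.cast (R := ZMod k)) hi
  have ht' : (m : ZMod k) = -c + 1 + t := by
    simpa only [Nat.cast_add, ZMod.natCast_zmod_val, Nat.cast_one] using
      congrArg (Nat.cast (R := ZMod k)) ht
  have hletter : w (r + t + 1) = w (0 + i + 1) := congrArg Prod.fst hquery
  rwa [show r + t + 1 = c + s by linear_combination hsum - ht',
    show 0 + (i : ZMod k) + 1 = c by linear_combination -hi'] at hletter

lemma exists_short_iterate (hM : ∀ u r, ¬ NoRepetition w u r M f) {o p : Fin n × ZMod k} {m : ℕ}
    (hm : 1 ≤ m) (h : (explode (curry f) w)^[m] o = p) :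
    ∃ m', 1 ≤ m' ∧ m' ≤ M ∧ (explode (curry f) w)^[m'] o = p := by
  classical
  have hex : ∃ m, 1 ≤ m ∧ (explode (curry f) w)^[m] o = p := ⟨m, hm, h⟩
  obtain ⟨hpos, hfind⟩ := Nat.find_spec hex
  refine ⟨Nat.find hex, hpos, ?_, hfind⟩
  by_contra! hlt
  obtain ⟨i, l, hl, hil, heq⟩ : ∃ i, ∃ l ≤ M, i < l ∧
      (explode (curry f) w)^[i] o = (explode (curry f) w)^[l] o := by
    by_contra! hcon
    refine hM o.1 o.2 fun i hi l hl heq => ?_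
    by_contra hne
    rcases lt_or_gt_of_ne hne with hlt | hlt
    · exact hcon i l hl hlt heq
    · exact hcon l i hi hlt heq.symm
  refine Nat.find_min hex (show Nat.find hex - l + i < Nat.find hex by lia) ⟨by lia, ?_⟩
  rw [iterate_add_apply, heq, ← iterate_add_apply, Nat.sub_add_cancel (by lia), hfind]

lemma exists_short_period (hM : ∀ u r, ¬ NoRepetition w u r M f) {o : Fin n × ZMod k}
    (ho : o ∈ periodicPts (explode (curry f) w)) :
    ∃ m, 1 ≤ m ∧ k * m ≤ M ∧ (explode (curry f) w)^[k * m] o = o := by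
  obtain ⟨m, hm, h⟩ := ho
  obtain ⟨m', hm', hle, h'⟩ := exists_short_iterate hM hm h
  obtain ⟨m, rfl⟩ := dvd_of_isPeriodicPt_explode h'
  exact ⟨m, Nat.pos_of_mul_pos_left hm', hle, h'⟩

lemma mul_minimalPeriod_le [NeZero k] (hM : ∀ u r, ¬ NoRepetition w u r M f)
    (hq : q ∈ periodicPts (inducedMap (curry f) w)) :
    k * minimalPeriod (inducedMap (curry f) w) q ≤ M := by
  obtain ⟨m, hm, hle, h⟩ := exists_short_period hM ((mem_periodicPts_explode_iff _ w q).2 hq)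
  rw [explode_iterate_mul] at h
  exact (Nat.mul_le_mul_left k (IsPeriodicPt.minimalPeriod_le hm (congrArg Prod.fst h))).trans hle

lemma exists_base_of_mem_specialVertices {α β : Type*} [LinearOrder β] {g : α → α} {σ : α → β}
    {y : α} (hy : y ∈ specialVertices g σ) :
    ∃ p ∈ periodicPts g, IsCycleMin g σ (g p) ∧ ∃ j ≤ 1, g^[j] p = y := by
  obtain ⟨hper, hmin | hmin⟩ := hy
  · obtain ⟨p, hp, rfl⟩ := (bijOn_periodicPts g).surjOn hper
    exact ⟨p, hp, hmin, 1, le_rfl, rfl⟩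
  · exact ⟨y, hper, hmin, 0, zero_le_one, rfl⟩

lemma exists_isSingleConfig [NeZero k] (hw : ¬ IsSelfConjugate w) (hkM : 2 * k ≤ M)
    (hM : ∀ u r, ¬ NoRepetition w u r M f)
    (hq : q ∈ periodicPts (inducedMap (curry f) w))
    (hmin : IsCycleMin (inducedMap (curry f) w) σ
      (inducedMap (curry f) w (inducedMap (curry f) w q)))
    {j' m : ℕ} {s : ZMod k} (hj' : j' ≤ 1) (hmM : m ≤ M) (hs : s ≠ 0)
    (h : (explode (curry f) w)^[m] ((inducedMap (curry f) w)^[j] q', r) =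
      ((inducedMap (curry f) w)^[j' + 1] q, s))
    (hstart : m < k → ∀ i, i + m = k * (j' + 1) →
      walk (curry f) w q 0 i ≠ (inducedMap (curry f) w)^[j] q') :
    ∃ (i₀ : Fin (2 * k + 1)) (τ₁ : Fin M) (τ₂ : Fin (3 * M)),
      IsSingleConfig w M f σ q q' j r i₀ τ₁ τ₂ := by
  have hkj : k * (j' + 1) ≤ 2 * k := by
    rw [mul_comm 2 k]
    exact Nat.mul_le_mul_left k (by lia)
  have hperiod := mul_minimalPeriod_le hM hq
  have hpos := Nat.mul_pos (NeZero.pos k) (minimalPeriod_pos_of_mem_periodicPts hq)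
  rw [← walk_mul _ w q (j' + 1), ← walk_mul _ w q' j] at h
  rcases exists_divergence hw (by lia) h hs with ⟨i, hi, t, ht, hne, heq⟩ | ⟨hm, i, hi, hwalk⟩
  · obtain ⟨τ₁, hτ₁, i₀, hi₀, τ₂, hτ₂, hτ, hle, hhit₁, hhit₂⟩ :=
      exists_two_hits (q := threeWalks w q q' (k * j) r M) (f := f) (M := M) (N := 2 * k) (i := i)
        (c := walk (curry f) w q 0) (t := 2 * M + t) (T := 3 * M)
        (fun t ht => by rw [threeWalks_first ht]; rfl) (by lia) hpos hperiod
        ((walk_mul _ _ _ _).trans (isPeriodicPt_minimalPeriod _ _)) hkM (by lia) (by lia)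
        (by rwa [threeWalks_third, threeWalks_first (by lia)])
        (by rwa [threeWalks_third, threeWalks_first (by lia)])
    exact ⟨⟨i₀, by lia⟩, ⟨τ₁, by lia⟩, ⟨τ₂, hτ₂⟩, hq, hmin, hτ₁, hτ, hle, hhit₁, hhit₂⟩
  · exact absurd (hwalk.trans (walk_mul _ w q' j)) (hstart hm i hi)

lemma exists_isSingleConfig_of_mem_periodicPts [NeZero k] (hw : ¬ IsSelfConjugate w)
    (hkM : 2 * k ≤ M) (hM : ∀ u r, ¬ NoRepetition w u r M f) {y : Fin n} {s : ZMod k}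
    (hy : y ∈ specialVertices (inducedMap (curry f) w) σ)
    (hper : (y, s) ∈ periodicPts (explode (curry f) w)) (hs : s ≠ 0) :
    ∃ (q : Fin n) (j : Fin 3) (r : ZMod k) (i₀ : Fin (2 * k + 1)) (τ₁ : Fin M) (τ₂ : Fin (3 * M)),
      IsSingleConfig w M f σ q q j r i₀ τ₁ τ₂ := by
  obtain ⟨p, hp, hmin, j, hj, rfl⟩ := exists_base_of_mem_specialVertices hy
  obtain ⟨q, hq, rfl⟩ := (bijOn_periodicPts _).surjOn hp
  obtain ⟨m, hm, hmM, h⟩ := exists_short_period hM hper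
  exact ⟨q, ⟨j + 1, by lia⟩, s, exists_isSingleConfig hw hkM hM hq hmin hj hmM hs h
    fun hlt => absurd hlt (Nat.le_mul_of_pos_right k hm).not_gt⟩

lemma dvd_of_walk_mem_specialVertices [NeZero k]
    (hzero : ∀ y ∈ specialVertices (inducedMap (curry f) w) σ, ∀ s : ZMod k,
      (y, s) ∈ periodicPts (explode (curry f) w) → s = 0)
    (hq : q ∈ periodicPts (inducedMap (curry f) w))
    (ht : walk (curry f) w q 0 t ∈ specialVertices (inducedMap (curry f) w) σ) : k ∣ t := by
  rw [← ZMod.natCast_eq_zero_iff]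
  refine hzero _ ht _ ?_
  have hper := (bijOn_periodicPts (explode (curry f) w)).mapsTo.iterate t
    ((mem_periodicPts_explode_iff _ w q).2 hq)
  rwa [explode_iterate, zero_add] at hper

lemma IsSingleConfig.exists_isDoubleConfig [NeZero k] {i₀ τ₁ τ₂ : ℕ}
    (h : IsSingleConfig w M f σ q q' j r i₀ τ₁ τ₂) (hM : ∀ u r, ¬ NoRepetition w u r M f)
    (hzero : ∀ y ∈ specialVertices (inducedMap (curry f) w) σ, ∀ s : ZMod k,
      (y, s) ∈ periodicPts (explode (curry f) w) → s = 0)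
    (hq' : q' ∈ periodicPts (inducedMap (curry f) w))
    (hmin' : IsCycleMin (inducedMap (curry f) w) σ (inducedMap (curry f) w q'))
    (hne : inducedMap (curry f) w (inducedMap (curry f) w q) ≠ inducedMap (curry f) w q') :
    ∃ τ₃ : Fin M, IsDoubleConfig w M f σ q q' j r i₀ τ₁ τ₂ τ₃ := by
  have hnever (t) : walk (curry f) w q 0 t ≠ q' := by
    intro ht
    obtain ⟨i, rfl⟩ := dvd_of_walk_mem_specialVertices hzero h.base_mem
      (ht ▸ ⟨hq', Or.inr hmin'⟩ : walk (curry f) w q 0 t ∈ _)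
    rw [walk_mul] at ht
    refine hne (h.isCycleMin.eq_of_iterate_eq_iterate σ.injective hmin' (i := i) (j := 1) ?_)
    rw [← iterate_succ_apply, ← iterate_succ_apply, iterate_succ_apply', iterate_succ_apply', ht]
    rfl
  have hperiod := mul_minimalPeriod_le hM hq'
  have hpos := Nat.mul_pos (NeZero.pos k) (minimalPeriod_pos_of_mem_periodicPts hq')
  obtain ⟨τ, hτ, hτq', hfresh⟩ := exists_isFresh_of_query (q := threeWalks w q q' (k * j) r M)
    (f := f) (t := M + (k * minimalPeriod (inducedMap (curry f) w) q' - 1)) (f · = q') (by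
      rw [threeWalks_second (by lia)]
      refine Eq.trans (congrArg (walk (curry f) w q' 0) (Nat.sub_add_cancel hpos)) ?_
      exact (walk_mul _ _ _ _).trans (isPeriodicPt_minimalPeriod _ _))
  have hMτ : M ≤ τ := by
    by_contra! hlt
    rw [threeWalks_first hlt] at hτq'
    exact hnever (τ + 1) hτq'
  obtain ⟨τ₃, rfl⟩ := Nat.exists_eq_add_of_le hMτ
  refine ⟨⟨τ₃, by lia⟩, h, hq', hmin', hne, show τ₃ < _ by lia, ?_, ?_, hfresh, hτq'⟩
  · rintro rfl
    exact hnever 0 (h.closing_isHit.2.symm.trans hτq')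
  · rintro rfl
    exact hnever _ (h.merging_isHit.2.symm.trans hτq')

lemma exists_config [NeZero k] (hw : ¬ IsSelfConjugate w) (hkM : 2 * k ≤ M)
    (hM : ∀ u r, ¬ NoRepetition w u r M f) (hbad : (curry f, σ) ∉ cycleGood n w) :
    (∃ (q : Fin n) (j : Fin 3) (r : ZMod k) (i₀ : Fin (2 * k + 1)) (τ₁ : Fin M) (τ₂ : Fin (3 * M)),
      IsSingleConfig w M f σ q q j r i₀ τ₁ τ₂) ∨
    ∃ (q q' : Fin n) (j : Fin 3) (r : ZMod k) (i₀ : Fin (2 * k + 1)) (τ₁ : Fin M)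
      (τ₂ : Fin (3 * M)) (τ₃ : Fin M), IsDoubleConfig w M f σ q q' j r i₀ τ₁ τ₂ τ₃ := by
  by_cases hzero : ∀ y ∈ specialVertices (inducedMap (curry f) w) σ, ∀ s : ZMod k,
      (y, s) ∈ periodicPts (explode (curry f) w) → s = 0
  swap
  · push Not at hzero
    obtain ⟨y, hy, s, hper, hs⟩ := hzero
    exact Or.inl (exists_isSingleConfig_of_mem_periodicPts hw hkM hM hy hper hs)
  obtain ⟨⟨x, r⟩, hx, m₀, hm₀, hy, hs⟩ : ∃ o : Fin n × ZMod k,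
      o.1 ∈ specialVertices (inducedMap (curry f) w) σ ∧ ∃ m ≥ 1,
      ((explode (curry f) w)^[m] o).1 ∈ specialVertices (inducedMap (curry f) w) σ ∧
      ((explode (curry f) w)^[m] o).2 ≠ 0 := by
    by_contra! hcon
    exact hbad hcon
  generalize ho : (explode (curry f) w)^[m₀] (x, r) = o at hy hs
  obtain ⟨y, s⟩ := o
  obtain ⟨m, hm, hmM, h⟩ := exists_short_iterate hM hm₀ ho
  obtain ⟨p, hp, hmin, j, hj, rfl⟩ := exists_base_of_mem_specialVertices hy
  obtain ⟨q, hq, rfl⟩ := (bijOn_periodicPts _).surjOn hp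
  obtain ⟨p, hp, hmin', j', hj', rfl⟩ := exists_base_of_mem_specialVertices hx
  have hstart (hlt : m < k) (i) (hi : i + m = k * (j + 1)) :
      walk (curry f) w q 0 i ≠ (inducedMap (curry f) w)^[j'] p := by
    intro heq
    have hdvd := dvd_of_walk_mem_specialVertices hzero hq (heq ▸ hx)
    have := Nat.le_of_dvd hm ((Nat.dvd_add_right hdvd).1 (hi ▸ dvd_mul_right k (j + 1)))
    lia
  by_cases hpq : inducedMap (curry f) w (inducedMap (curry f) w q) = inducedMap (curry f) w p
  · obtain rfl := (bijOn_periodicPts _).injOn ((bijOn_periodicPts _).mapsTo hq) hp hpq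
    exact Or.inl ⟨q, ⟨j' + 1, by lia⟩, r,
      exists_isSingleConfig hw hkM hM hq hmin hj hmM hs h hstart⟩
  · obtain ⟨i₀, τ₁, τ₂, hsingle⟩ := exists_isSingleConfig hw hkM hM hq hmin hj hmM hs h hstart
    exact Or.inr ⟨q, p, ⟨j', by lia⟩, r, i₀, τ₁, τ₂,
      hsingle.exists_isDoubleConfig hM hzero hp hmin' hpq⟩

end Configurations

/-! ### Pairs that are not good are rare -/

section Counting

variable {n k : ℕ} {w : Word k} {q q' : Fin n} {r : ZMod k} {M j i₀ τ₁ τ₂ τ₃ : ℕ}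

lemma IsAdaptive.prob_prod_le_of_forall_isHit {α β γ : Type*} [Finite α] [Fintype β] [Nonempty β]
    [Finite γ] {q : (α → β) → ℕ → α} (h : IsAdaptive q) (z : ℕ → (α → β) → β) (T : Finset ℕ)
    (hz : ∀ τ ∈ T, IsDeterminedBefore q τ (z τ)) {S : Set ((α → β) × γ)} {c : ℝ}
    (hS : ∀ x ∈ S, ∀ τ ∈ T, IsHit q x.1 τ (z τ x.1)) (hc : ∀ f, prob {y | (f, y) ∈ S} ≤ c) :
    prob S ≤ 1 / (Fintype.card β : ℝ) ^ T.card * c := by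
  classical
  exact (prob_prod_le (H := {f | ∀ τ ∈ T, IsHit q f τ (z τ f)}) (fun f _ => hc f) hS).trans
    (mul_le_mul_of_nonneg_right (h.prob_hits_le z T hz)
      ((prob_nonneg _).trans (hc fun _ => Classical.arbitrary β)))

lemma prob_isSingleConfig_label_le (f : Letter × Fin n → Fin n) :
    prob {σ : Equiv.Perm (Fin n) | IsSingleConfig w M f σ q q' j r i₀ τ₁ τ₂} ≤
      k / (τ₁ + 1) := by
  rcases Set.eq_empty_or_nonempty
    {σ : Equiv.Perm (Fin n) | IsSingleConfig w M f σ q q' j r i₀ τ₁ τ₂} with h | ⟨σ₀, h⟩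
  · rw [h, prob_empty]
    positivity
  have hq := h.base_mem
  have hmaps := (bijOn_periodicPts (inducedMap (curry f) w)).mapsTo
  refine (prob_mono fun σ hσ => hσ.isCycleMin).trans
    ((prob_isCycleMin_le (hmaps (hmaps hq))).trans ?_)
  rw [minimalPeriod_apply (hmaps hq), minimalPeriod_apply hq]
  exact one_div_le_of_lt_mul h.closing_lt

lemma prob_isDoubleConfig_label_le (f : Letter × Fin n → Fin n) :
    prob {σ : Equiv.Perm (Fin n) | IsDoubleConfig w M f σ q q' j r i₀ τ₁ τ₂ τ₃} ≤
      k / (τ₁ + 1) * (k / (τ₃ + 1)) := by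
  rcases Set.eq_empty_or_nonempty
    {σ : Equiv.Perm (Fin n) | IsDoubleConfig w M f σ q q' j r i₀ τ₁ τ₂ τ₃} with h | ⟨σ₀, h⟩
  · rw [h, prob_empty]
    positivity
  have hq := h.base_mem
  have hq' := h.base_mem'
  have hmaps := (bijOn_periodicPts (inducedMap (curry f) w)).mapsTo
  have hsub : {σ : Equiv.Perm (Fin n) | IsDoubleConfig w M f σ q q' j r i₀ τ₁ τ₂ τ₃} ⊆
      {σ | IsCycleMin (inducedMap (curry f) w) σ
        (inducedMap (curry f) w (inducedMap (curry f) w q)) ∧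
        IsCycleMin (inducedMap (curry f) w) σ (inducedMap (curry f) w q')} :=
    fun σ hσ => ⟨hσ.isCycleMin, hσ.isCycleMin'⟩
  refine (prob_mono hsub).trans
    ((prob_isCycleMin_isCycleMin_le (hmaps (hmaps hq)) (hmaps hq') h.isCycleMin_ne).trans ?_)
  rw [minimalPeriod_apply (hmaps hq), minimalPeriod_apply hq, minimalPeriod_apply hq']
  exact mul_le_mul (one_div_le_of_lt_mul h.closing_lt) (one_div_le_of_lt_mul h.closing_lt')
    (by positivity) (by positivity)

lemma prob_isSingleConfig_le [NeZero n] (hj : k * j ≤ M) (hi₀ : i₀ ≤ M) :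
    prob {x : (Letter × Fin n → Fin n) × Equiv.Perm (Fin n) |
      IsSingleConfig w M x.1 x.2 q q' j r i₀ τ₁ τ₂} ≤ 1 / n ^ 2 * (k / (τ₁ + 1)) := by
  rcases Set.eq_empty_or_nonempty {x : (Letter × Fin n → Fin n) × Equiv.Perm (Fin n) |
    IsSingleConfig w M x.1 x.2 q q' j r i₀ τ₁ τ₂} with h | ⟨x, hx⟩
  · rw [h, prob_empty]
    positivity
  have hne := hx.closing_ne
  have hprob := (isAdaptive_threeWalks (w := w) (q := q) (q' := q') (r := r)
    hj).prob_prod_le_of_forall_isHit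
    (fun τ f => if τ = τ₁ then q else walk (curry f) w q 0 i₀) {τ₁, τ₂} ?_
    (S := {x | IsSingleConfig w M x.1 x.2 q q' j r i₀ τ₁ τ₂}) ?_ prob_isSingleConfig_label_le
  · rwa [Finset.card_pair hne, Fintype.card_fin] at hprob
  · simp only [Finset.mem_insert, Finset.mem_singleton, forall_eq_or_imp, forall_eq, if_true,
      if_neg hne.symm]
    exact ⟨fun _ _ _ => rfl, isDeterminedBefore_threeWalks_walk hi₀ hx.start_le⟩
  · intro x hx
    simp only [Finset.mem_insert, Finset.mem_singleton, forall_eq_or_imp, forall_eq, if_true,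
      if_neg hne.symm]
    exact ⟨hx.closing_isHit, hx.merging_isHit⟩

lemma prob_isDoubleConfig_le [NeZero n] (hj : k * j ≤ M) (hi₀ : i₀ ≤ M) :
    prob {x : (Letter × Fin n → Fin n) × Equiv.Perm (Fin n) |
      IsDoubleConfig w M x.1 x.2 q q' j r i₀ τ₁ τ₂ τ₃} ≤
      1 / n ^ 3 * (k / (τ₁ + 1) * (k / (τ₃ + 1))) := by
  rcases Set.eq_empty_or_nonempty {x : (Letter × Fin n → Fin n) × Equiv.Perm (Fin n) |
    IsDoubleConfig w M x.1 x.2 q q' j r i₀ τ₁ τ₂ τ₃} with h | ⟨x, hx⟩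
  · rw [h, prob_empty]
    positivity
  have hne := hx.closing_ne
  have hprob := (isAdaptive_threeWalks (w := w) (q := q) (q' := q') (r := r)
    hj).prob_prod_le_of_forall_isHit
    (fun τ f => if τ = τ₁ then q else if τ = τ₂ then walk (curry f) w q 0 i₀ else q')
    {τ₁, τ₂, M + τ₃} ?_
    (S := {x | IsDoubleConfig w M x.1 x.2 q q' j r i₀ τ₁ τ₂ τ₃}) ?_ prob_isDoubleConfig_label_le
  · rwa [Finset.card_eq_three.2 ⟨_, _, _, hne, hx.closing_ne', hx.merging_ne', rfl⟩,
      Fintype.card_fin] at hprob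
  · simp only [Finset.mem_insert, Finset.mem_singleton, forall_eq_or_imp, forall_eq, if_true,
      if_neg hne.symm, if_neg hx.closing_ne'.symm,
      if_neg hx.merging_ne'.symm]
    exact ⟨fun _ _ _ => rfl, isDeterminedBefore_threeWalks_walk hi₀ hx.start_le, fun _ _ _ => rfl⟩
  · intro y hy
    simp only [Finset.mem_insert, Finset.mem_singleton, forall_eq_or_imp, forall_eq, if_true,
      if_neg hne.symm, if_neg hx.closing_ne'.symm,
      if_neg hx.merging_ne'.symm]
    exact ⟨hy.closing_isHit, hy.merging_isHit, hy.closing_isHit'⟩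

lemma sum_div_add_one (c : ℝ) (M : ℕ) :
    ∑ τ : Fin M, c / ((τ : ℕ) + 1) = c * harmonic M := by
  rw [Fin.sum_univ_eq_sum_range (fun τ => c / ((τ : ℝ) + 1)), harmonic, Rat.cast_sum,
    Finset.mul_sum]
  refine Finset.sum_congr rfl fun τ _ => ?_
  push_cast
  rfl

lemma prob_exists_noRepetition_le [NeZero k] (w : Word k) {a : ℕ} (ha : a < n) :
    prob {x : (Letter × Fin n → Fin n) × Equiv.Perm (Fin n) |
      ∃ u r, NoRepetition w u r (2 * k * (k * a)) x.1} ≤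
      n * k * Real.exp (-((a : ℝ) ^ 2 / n)) := by
  have hunion : {x : (Letter × Fin n → Fin n) × Equiv.Perm (Fin n) |
      ∃ u r, NoRepetition w u r (2 * k * (k * a)) x.1} =
      ⋃ p : Fin n × ZMod k, {x | NoRepetition w p.1 p.2 (2 * k * (k * a)) x.1} := by
    ext
    simp only [Set.mem_ofPred_eq, Set.mem_iUnion, Prod.exists]
  have hle (p : Fin n × ZMod k) :
      prob {x : (Letter × Fin n → Fin n) × Equiv.Perm (Fin n) |
        NoRepetition w p.1 p.2 (2 * k * (k * a)) x.1} ≤ Real.exp (-((a : ℝ) ^ 2 / n)) := by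
    refine (prob_prod_le (H := {f | NoRepetition w p.1 p.2 (2 * k * (k * a)) f}) (c := 1)
      (fun f _ => (prob_mono (Set.subset_univ _)).trans_eq prob_univ) fun x hx => hx).trans ?_
    rw [mul_one]
    exact prob_noRepetition_le w p.1 p.2 ha
  rw [hunion]
  refine (prob_iUnion_le _).trans ((Finset.sum_le_sum fun p _ => hle p).trans_eq ?_)
  rw [Finset.sum_const, Finset.card_univ, Fintype.card_prod, Fintype.card_fin, ZMod.card,
    nsmul_eq_mul, Nat.cast_mul]

lemma prob_exists_isSingleConfig_le [NeZero n] [NeZero k] (w : Word k) (hkM : 2 * k ≤ M) :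
    prob {x : (Letter × Fin n → Fin n) × Equiv.Perm (Fin n) |
      ∃ (q : Fin n) (j : Fin 3) (r : ZMod k) (i₀ : Fin (2 * k + 1)) (τ₁ : Fin M)
        (τ₂ : Fin (3 * M)), IsSingleConfig w M x.1 x.2 q q j r i₀ τ₁ τ₂} ≤
      9 * k ^ 2 * (2 * k + 1) * M * harmonic M / n := by
  have hn := NeZero.ne n
  have hunion : {x : (Letter × Fin n → Fin n) × Equiv.Perm (Fin n) |
      ∃ (q : Fin n) (j : Fin 3) (r : ZMod k) (i₀ : Fin (2 * k + 1)) (τ₁ : Fin M)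
        (τ₂ : Fin (3 * M)), IsSingleConfig w M x.1 x.2 q q j r i₀ τ₁ τ₂} =
      ⋃ p : Fin n × Fin 3 × ZMod k × Fin (2 * k + 1) × Fin M × Fin (3 * M),
        {x | IsSingleConfig w M x.1 x.2 p.1 p.1 p.2.1 p.2.2.1 p.2.2.2.1 p.2.2.2.2.1
          p.2.2.2.2.2} := by
    ext
    simp only [Set.mem_ofPred_eq, Set.mem_iUnion, Prod.exists]
  rw [hunion]
  refine (prob_iUnion_le _).trans ((Finset.sum_le_sum fun p _ => prob_isSingleConfig_le
    (by nlinarith [p.2.1.2]) (by lia)).trans_eq ?_)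
  simp only [Fintype.sum_prod_type, Finset.sum_const, Finset.card_univ, Fintype.card_fin,
    nsmul_eq_mul, ZMod.card, ← Finset.mul_sum, sum_div_add_one]
  push_cast
  field_simp
  ring

lemma prob_exists_isDoubleConfig_le [NeZero n] [NeZero k] (w : Word k) (hkM : 2 * k ≤ M) :
    prob {x : (Letter × Fin n → Fin n) × Equiv.Perm (Fin n) |
      ∃ (q q' : Fin n) (j : Fin 3) (r : ZMod k) (i₀ : Fin (2 * k + 1)) (τ₁ : Fin M)
        (τ₂ : Fin (3 * M)) (τ₃ : Fin M), IsDoubleConfig w M x.1 x.2 q q' j r i₀ τ₁ τ₂ τ₃} ≤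
      9 * k ^ 3 * (2 * k + 1) * M * harmonic M ^ 2 / n := by
  have hn := NeZero.ne n
  have hunion : {x : (Letter × Fin n → Fin n) × Equiv.Perm (Fin n) |
      ∃ (q q' : Fin n) (j : Fin 3) (r : ZMod k) (i₀ : Fin (2 * k + 1)) (τ₁ : Fin M)
        (τ₂ : Fin (3 * M)) (τ₃ : Fin M), IsDoubleConfig w M x.1 x.2 q q' j r i₀ τ₁ τ₂ τ₃} =
      ⋃ p : Fin n × Fin n × Fin 3 × ZMod k × Fin (2 * k + 1) × Fin M × Fin (3 * M) × Fin M,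
        {x | IsDoubleConfig w M x.1 x.2 p.1 p.2.1 p.2.2.1 p.2.2.2.1 p.2.2.2.2.1 p.2.2.2.2.2.1
          p.2.2.2.2.2.2.1 p.2.2.2.2.2.2.2} := by
    ext
    simp only [Set.mem_ofPred_eq, Set.mem_iUnion, Prod.exists]
  rw [hunion]
  refine (prob_iUnion_le _).trans ((Finset.sum_le_sum fun p _ => prob_isDoubleConfig_le
    (by nlinarith [p.2.2.1.2]) (by lia)).trans_eq ?_)
  simp only [Fintype.sum_prod_type, Finset.sum_const, Finset.card_univ, Fintype.card_fin,
    nsmul_eq_mul, ZMod.card, ← Finset.mul_sum, ← Finset.sum_mul, sum_div_add_one]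
  push_cast
  field_simp
  ring

/-- An upper bound for the probability that a pair of an automaton on `[n]` and a labelling is not
good for a word of length `k`. The free parameter `a` sets the length `2 k² a` beyond which a thread
counts as long. -/
noncomputable def errorTerm (n k a : ℕ) : ℝ :=
  n * k * Real.exp (-((a : ℝ) ^ 2 / n)) +
    18 * (k : ℝ) ^ 3 * (2 * k + 1) * (2 * k * (k * a) : ℕ) *
      (1 + Real.log (2 * k * (k * a) : ℕ)) ^ 2 / n

lemma add_harmonic_le_errorTerm (n : ℕ) {a : ℕ} (hk : 1 ≤ k) (hM : M = 2 * k * (k * a))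
    (hM₁ : 1 ≤ M) :
    n * k * Real.exp (-((a : ℝ) ^ 2 / n)) + (9 * k ^ 2 * (2 * k + 1) * M * harmonic M / n +
      9 * k ^ 3 * (2 * k + 1) * M * harmonic M ^ 2 / n) ≤ errorTerm n k a := by
  have hharmonic : (harmonic M : ℝ) ≤ 1 + Real.log M := harmonic_le_one_add_log M
  have hlog : 1 ≤ 1 + Real.log M := le_add_of_nonneg_right (Real.log_nonneg (mod_cast hM₁))
  have hharmonic₀ : (0 : ℝ) ≤ harmonic M := mod_cast (harmonic_pos (by lia)).le
  rw [errorTerm, ← hM]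
  calc _ ≤ n * k * Real.exp (-((a : ℝ) ^ 2 / n)) +
        (9 * k ^ 3 * (2 * k + 1) * M * (1 + Real.log M) ^ 2 / n +
        9 * k ^ 3 * (2 * k + 1) * M * (1 + Real.log M) ^ 2 / n) := by
        gcongr
        · exact_mod_cast hk
        · norm_num
        · exact hharmonic.trans (le_self_pow₀ hlog two_ne_zero)
    _ = _ := by ring

lemma one_sub_errorTerm_le_prob_cycleGood [NeZero n] [NeZero k] (hw : ¬ IsSelfConjugate w) {a : ℕ}
    (ha : 1 ≤ a) (han : a < n) : 1 - errorTerm n k a ≤ prob (cycleGood n w) := by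
  have hka : 1 ≤ k * a := Nat.mul_pos (NeZero.pos k) ha
  obtain ⟨M, hM⟩ : ∃ M, M = 2 * k * (k * a) := ⟨_, rfl⟩
  have hkM : 2 * k ≤ M := hM ▸ Nat.le_mul_of_pos_right _ hka
  let curryEquiv : (Letter × Fin n → Fin n) × Equiv.Perm (Fin n) ≃
      Automaton n × Equiv.Perm (Fin n) :=
    (Equiv.curry Letter (Fin n) (Fin n)).prodCongr (Equiv.refl _)
  have hcover : (Set.univ : Set ((Letter × Fin n → Fin n) × Equiv.Perm (Fin n))) ⊆
      curryEquiv ⁻¹' cycleGood n w ∪ ({x | ∃ u r, NoRepetition w u r M x.1} ∪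
      ({x | ∃ (q : Fin n) (j : Fin 3) (r : ZMod k) (i₀ : Fin (2 * k + 1)) (τ₁ : Fin M)
        (τ₂ : Fin (3 * M)), IsSingleConfig w M x.1 x.2 q q j r i₀ τ₁ τ₂} ∪
      {x | ∃ (q q' : Fin n) (j : Fin 3) (r : ZMod k) (i₀ : Fin (2 * k + 1)) (τ₁ : Fin M)
        (τ₂ : Fin (3 * M)) (τ₃ : Fin M), IsDoubleConfig w M x.1 x.2 q q' j r i₀ τ₁ τ₂ τ₃})) := by
    rintro ⟨f, σ⟩ -
    by_cases hgood : (curry f, σ) ∈ cycleGood n w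
    · exact Or.inl hgood
    by_cases hlong : ∃ u r, NoRepetition w u r M f
    · exact Or.inr (Or.inl hlong)
    push Not at hlong
    exact Or.inr (Or.inr (exists_config hw hkM hlong hgood))
  have hprob := (prob_mono hcover).trans <| (prob_union_le _ _).trans <| add_le_add le_rfl <|
    (prob_union_le _ _).trans <| add_le_add (hM ▸ prob_exists_noRepetition_le w han) <|
    (prob_union_le _ _).trans <|
    add_le_add (prob_exists_isSingleConfig_le w hkM) (prob_exists_isDoubleConfig_le w hkM)
  rw [prob_univ, prob_preimage] at hprob
  have := add_harmonic_le_errorTerm n (NeZero.pos k) hM (by lia)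
  linarith

end Counting

/-! ### The error term vanishes uniformly -/

section Asymptotics

open Filter Topology

variable {n k a : ℕ} {y : ℝ}

lemma mul_exp_neg_sq_div_le (hy : 1 ≤ y) (hn : (n : ℝ) = y ^ 30) (hk : (k : ℝ) ≤ y)
    (ha : y ^ 20 ≤ a) :
    n * k * Real.exp (-((a : ℝ) ^ 2 / n)) ≤ (y ^ 10) ^ 4 * Real.exp (-y ^ 10) := by
  have hexponent : y ^ 10 ≤ (a : ℝ) ^ 2 / n := by
    rw [hn, le_div_iff₀ (by positivity)]
    calc y ^ 10 * y ^ 30 = (y ^ 20) ^ 2 := by ring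
      _ ≤ (a : ℝ) ^ 2 := by gcongr
  calc n * k * Real.exp (-((a : ℝ) ^ 2 / n)) ≤ y ^ 30 * y * Real.exp (-y ^ 10) := by
        rw [hn] at hexponent ⊢
        gcongr
    _ ≤ (y ^ 10) ^ 4 * Real.exp (-y ^ 10) := by
        rw [← pow_succ, ← pow_mul]
        gcongr
        norm_num

lemma polynomial_mul_log_sq_div_le (hy : 2 ≤ y) (hn : (n : ℝ) = y ^ 30) (hlog : 1 + Real.log n ≤ y)
    (hk₁ : 1 ≤ k) (hk : (k : ℝ) ≤ y) (ha₁ : 1 ≤ a) (ha : (a : ℝ) ≤ 2 * y ^ 20) :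
    18 * (k : ℝ) ^ 3 * (2 * k + 1) * (2 * k * (k * a) : ℕ) *
      (1 + Real.log (2 * k * (k * a) : ℕ)) ^ 2 / n ≤ 216 / y ^ 2 := by
  obtain ⟨M, hM⟩ : ∃ M, M = 2 * k * (k * a) := ⟨_, rfl⟩
  have hM₁ : (1 : ℝ) ≤ M := by
    rw [hM]
    exact_mod_cast (by positivity : 0 < 2 * k * (k * a))
  have hMy : (M : ℝ) ≤ 4 * y ^ 22 := by
    rw [hM]
    push_cast
    calc 2 * (k : ℝ) * (k * a) ≤ 2 * y * (y * (2 * y ^ 20)) := by gcongr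
      _ = 4 * y ^ 22 := by ring
  have hMn : (M : ℝ) ≤ n := by
    calc (M : ℝ) ≤ 2 ^ 8 * y ^ 22 := hMy.trans (by gcongr; norm_num)
      _ ≤ y ^ 8 * y ^ 22 := by gcongr
      _ = n := by rw [hn]; ring
  have hlogM : 1 + Real.log M ≤ y := by
    linarith [Real.log_le_log (zero_lt_one.trans_le hM₁) hMn]
  have := Real.log_nonneg hM₁
  have : (1 : ℝ) ≤ k := mod_cast hk₁
  rw [← hM, hn, div_le_div_iff₀ (by positivity) (by positivity)]
  calc 18 * (k : ℝ) ^ 3 * (2 * k + 1) * M * (1 + Real.log M) ^ 2 * y ^ 2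
      ≤ 18 * y ^ 3 * (3 * y) * (4 * y ^ 22) * y ^ 2 * y ^ 2 := by
        gcongr
        linarith
    _ = 216 * y ^ 30 := by ring

lemma tendsto_pow_mul_exp_neg_pow_add_div :
    Tendsto (fun y : ℝ => (y ^ 10) ^ 4 * Real.exp (-y ^ 10) + 216 / y ^ 2) atTop (𝓝 0) := by
  have hexp := (Real.tendsto_pow_mul_exp_neg_atTop_nhds_zero 4).comp
    (tendsto_pow_atTop (α := ℝ) (n := 10) (by norm_num))
  have hdiv := (tendsto_pow_atTop (α := ℝ) two_ne_zero).const_div_atTop 216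
  simpa only [comp_def, add_zero] using hexp.add hdiv

lemma eventually_log_le_rpow :
    ∀ᶠ x : ℝ in atTop, 2 * Real.logb 2 x ≤ x ^ (1 / 30 : ℝ) ∧
      1 + Real.log x ≤ x ^ (1 / 30 : ℝ) := by
  have hlog {c : ℝ} (hc : 0 < c) : ∀ᶠ x : ℝ in atTop, Real.log x ≤ c * x ^ (1 / 30 : ℝ) := by
    filter_upwards [(isLittleO_log_rpow_atTop (r := 1 / 30) (by norm_num)).bound hc,
      eventually_ge_atTop 0] with x hx hx₀
    rw [Real.norm_of_nonneg (Real.rpow_nonneg hx₀ _)] at hx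
    exact (le_abs_self _).trans hx
  have hlog₂ := Real.log_pos one_lt_two
  filter_upwards [hlog (half_pos hlog₂), hlog one_half_pos,
    (tendsto_rpow_atTop (y := 1 / 30) (by norm_num)).eventually_ge_atTop 2] with x hx hx' hy
  refine ⟨?_, by linarith⟩
  rw [Real.logb, ← mul_div_assoc, div_le_iff₀ hlog₂]
  linarith

lemma eventually_exists_errorTerm_le {ε : ℝ} (hε : 0 < ε) :
    ∀ᶠ n : ℕ in atTop, ∀ k : ℕ, 1 ≤ k → (k : ℝ) ≤ 2 * Real.logb 2 n →
      ∃ a, 1 ≤ a ∧ a < n ∧ errorTerm n k a ≤ ε := by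
  have hy : Tendsto (fun x : ℝ => x ^ (1 / 30 : ℝ)) atTop atTop :=
    tendsto_rpow_atTop (by norm_num)
  have hlarge : ∀ᶠ n : ℕ in atTop, _ := tendsto_natCast_atTop_atTop.eventually <|
    eventually_log_le_rpow.and <| (hy.eventually_ge_atTop 2).and <|
    (tendsto_pow_mul_exp_neg_pow_add_div.comp hy).eventually_le_const hε
  filter_upwards [hlarge] with n hn k hk hkn
  obtain ⟨⟨hlog₂, hlog⟩, hy, herror⟩ := hn
  set y := (n : ℝ) ^ (1 / 30 : ℝ)
  have hny : (n : ℝ) = y ^ 30 := by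
    rw [← Real.rpow_natCast, ← Real.rpow_mul n.cast_nonneg]
    norm_num
  have hy₁ : 1 ≤ y := one_le_two.trans hy
  have hy₂₀ : 1 ≤ y ^ 20 := one_le_pow₀ hy₁
  have ha := Nat.le_ceil (y ^ 20)
  have ha' : (⌈y ^ 20⌉₊ : ℝ) ≤ 2 * y ^ 20 := by
    linarith [Nat.ceil_lt_add_one (zero_le_one.trans hy₂₀)]
  have ha₁ : 1 ≤ ⌈y ^ 20⌉₊ := Nat.one_le_ceil_iff.2 (by positivity)
  refine ⟨⌈y ^ 20⌉₊, ha₁, ?_, le_trans (add_le_add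
    (mul_exp_neg_sq_div_le hy₁ hny (hkn.trans hlog₂) ha)
    (polynomial_mul_log_sq_div_le hy hny hlog hk (hkn.trans hlog₂) ha₁ ha')) herror⟩
  have : (⌈y ^ 20⌉₊ : ℝ) < n := by
    calc (⌈y ^ 20⌉₊ : ℝ) ≤ 2 * y ^ 20 := ha'
      _ ≤ y * y ^ 20 := by gcongr
      _ = y ^ 21 := by ring
      _ < y ^ 30 := pow_lt_pow_right₀ (by linarith) (by norm_num)
      _ = n := hny.symm
  exact_mod_cast this

end Asymptotics

lemma natCard_markedLabelledAutomaton (n : ℕ) :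
    Nat.card (MarkedLabelledAutomaton n) = Nat.card (Automaton n × Equiv.Perm (Fin n)) * n := by
  rw [MarkedLabelledAutomaton, Nat.card_prod, Nat.card_prod, Nat.card_prod, Nat.card_fin]
  ring

lemma abs_ncard_goodMarkedTrees_div_sub_one_le {n k a : ℕ} [NeZero n] [NeZero k] {w : Word k}
    (hw : ¬ IsSelfConjugate w) (ha : 1 ≤ a) (han : a < n) :
    |((goodMarkedTrees n w).ncard : ℝ) /
      ((Nat.card (MarkedLabelledAutomaton n) : ℝ) / (n : ℝ)) - 1| ≤ errorTerm n k a := by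
  have hn : (n : ℝ) ≠ 0 := NeZero.ne _
  rw [natCard_markedLabelledAutomaton, Nat.cast_mul, mul_div_cancel_right₀ _ hn]
  have hpos : (0 : ℝ) < Nat.card (Automaton n × Equiv.Perm (Fin n)) := mod_cast Nat.card_pos
  have hupper : ((goodMarkedTrees n w).ncard : ℝ) / Nat.card (Automaton n × Equiv.Perm (Fin n)) ≤
      1 := (div_le_one hpos).2 (mod_cast ncard_goodMarkedTrees_le w)
  have hlower : 1 - errorTerm n k a ≤
      ((goodMarkedTrees n w).ncard : ℝ) / Nat.card (Automaton n × Equiv.Perm (Fin n)) :=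
    (one_sub_errorTerm_le_prob_cycleGood hw ha han).trans <|
      div_le_div_of_nonneg_right (mod_cast ncard_cycleGood_le w) hpos.le
  rw [abs_le]
  constructor <;> linarith

theorem mainTheorem7 :
    ∀ ε : ℝ, 0 < ε → ∃ N : ℕ, ∀ n : ℕ, N ≤ n → ∀ k : ℕ, 1 ≤ k →
      (k : ℝ) ≤ 2 * Real.logb 2 (n : ℝ) → ∀ w : Word k, ¬ IsSelfConjugate w →
        |((goodMarkedTrees n w).ncard : ℝ) /
            ((Nat.card (MarkedLabelledAutomaton n) : ℝ) / (n : ℝ)) - 1| ≤ ε ∧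
        |uniformProb (goodMarkedTrees n w) / (1 / (n : ℝ)) - 1| ≤ ε := by
  intro ε hε
  obtain ⟨N, hN⟩ := Filter.eventually_atTop.1 (eventually_exists_errorTerm_le hε)
  refine ⟨N, fun n hn k hk hkn w hw => ?_⟩
  obtain ⟨a, ha, han, herror⟩ := hN n hn k hk hkn
  have : NeZero n := ⟨by lia⟩
  have : NeZero k := ⟨by lia⟩
  have hratio := (abs_ncard_goodMarkedTrees_div_sub_one_le hw ha han).trans herror
  have hprob : uniformProb (goodMarkedTrees n w) / (1 / (n : ℝ)) =
      (goodMarkedTrees n w).ncard / ((Nat.card (MarkedLabelledAutomaton n) : ℝ) / n) := by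
    rw [uniformProb, div_div_div_eq, mul_one, div_div_eq_mul_div, mul_div_assoc]
  exact ⟨hratio, hprob ▸ hratio⟩
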